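/- **Setting.** Let $G=(V,E)$ be a finite connected simple graph with $N=|V|$ vertices and $K=|E|\ge 2$ edges, such that every vertex has degree less than $z$ and, for every edge $e$ and every $l\ge1$, at most $\gamma^l$ connected sets of $l$ edges contain $e$. Each vertex carries a spin with Hilbert space $\mathbb C^d$, $d\ge 1$. Let $H=\sum_{e\in E}h_e$, where each $h_e$ is Hermitian, acts non-trivially only on the two ends of $e$, and has operator norm $\|h_e\|\le 1$. Write $\|A\|_1=\operatorname{tr}(A^\dagger A)^{1/2}$. An operator $\rho$ is a PEPO on $G$ of bond dimension $D$ if $\rho=\sum_{\alpha:E\to\{1,\dots,D\}}\bigotimes_{v\in V}X^v_{(\alpha(e))_{e\ni v}}$ with operators $X^v_{\cdots}$ on $\mathbb C^d$; PEPS are defined in the same way with vectors in $\mathbb C^d$ in place of operators. Fix an enumeration $h_1,\dots,h_K$ of the interaction terms. For integers $M\ge 1$, $L\ge0$, $\beta\ge 0$, and $1\le i\le 2K$ put $\tilde h_i=h_{K+1-i}$ if $i\le K$, $\tilde h_i=h_{i-K}$ if $i>K$, and $x_i=e^{-\beta\tilde h_i/2M}-1$. With $\tau=\prod_{i=1}^K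 e^{-\beta h_i/2M}$ one has $(\tau^\dagger\tau)^M=\prod_{j=1}^M\prod_{i=1}^{2K}(1+x_i)$. The truncated Trotter expansion is $$\tilde\rho=\tilde\rho_{M,L}=\sum_{\lambda}\ \prod_{j=1}^M\prod_{i=1}^{2K}x_i^{\lambda_{j,i}},$$ where $\lambda$ runs over the $M\times 2K$ matrices with entries in $\{0,1\}$ and at most $L$ ones in every column. **(a) Gibbs states.** For every $b\ge0$ there are $C>0$ and $p\in\mathbb N$, depending only on $b$, and for every $d\ge 1$ there is $C'>0$, depending only on $b$ and $d$, such that for every system as above (with any $z$, $\gamma$), every $0\le\beta\le b\log N$ and every $0<\varepsilon\le1$ there are integers $M\ge1$ and $L$ with $$M\le C\,(K/\varepsilon)^p,\qquad L\le C\log(K/\varepsilon),\qquad \|e^{-\beta H}-\tilde\rho_{M,L}\|_1\le\varepsilon\,\|e^{-\beta H}\|_1 .$$ Moreover each $x_i$ is a sum of $d^2$ products of one-site operators at the two ends of its edge; and whenever $1\le s\le d^2$ and every $x_i$ is a sum of $s$ such products, $\tilde\rho_{M,L}$ is a PEPO on $G$ of a bond dimension $D$ with $$D\le L^2(sM)^{2L}\qquad\text{and}\qquad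 D\le e^{C'\log^2(N/\varepsilon)} .$$ In particular the constants do not depend on $z$ or $\gamma$, hence not on a lattice dimension. **(b) Ground states.** For all $d\ge1$, $\Delta>0$ and $\kappa\ge0$ there is $C>0$, depending only on $d,\Delta,\kappa$, such that the following holds for every system as above. Suppose that $H$ has a normalised ground state $\Psi$ of energy $E_0$, that every eigenvector orthogonal to $\Psi$ has eigenvalue at least $E_0+\Delta$, and that for every $E\ge0$ the number of eigenvalues of $H$ (with multiplicity) that are at most $E_0+E$ is at most $N^{\kappa(1+E)}$. Then for every $0<\varepsilon\le 1$ there are $D\le e^{C\log^2(N/\varepsilon)}$, a PEPO $\sigma$ on $G$ of bond dimension $D$ with $\big\||\Psi\rangle\langle\Psi|-\sigma\big\|_1\le\varepsilon$, and a PEPS $\Phi$ on $G$ of bond dimension $D$ with $\|\Psi-\Phi\|\le\varepsilon$. -/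

import Mathlib

open scoped Matrix Matrix.Norms.L2Operator

universe u

namespace GibbsPEPO

noncomputable section

/-- Operators on the Hilbert space `⨂_{v ∈ V} ℂ^d` of spins of dimension `d` sitting at the
vertices, written in the product basis, which is indexed by the configurations `V → Fin d`.
The norm `‖A‖` on it is the operator norm. -/
abbrev Op (V : Type u) (d : ℕ) : Type u := Matrix (V → Fin d) (V → Fin d) ℂ

variable {V : Type u} [Fintype V] [DecidableEq V] {d : ℕ}

/-- The tensor product `⨂_v A_v` of one-site operators. -/
def siteTensor (A : V → Matrix (Fin d) (Fin d) ℂ) : Op V d :=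
  Matrix.of fun σ τ => ∏ v, A v (σ v) (τ v)

/-- `A` acts non-trivially only on the spins in `S`, that is `A = a ⊗ 1` with `a` an operator on
the spins in `S`. -/
def ActsOn (S : Set V) (A : Op V d) : Prop :=
  ∃ a : Matrix (S → Fin d) (S → Fin d) ℂ, ∀ σ τ : V → Fin d,
    ((∀ v ∉ S, σ v = τ v) → A σ τ = a (fun v => σ v) (fun v => τ v)) ∧
    ((∃ v ∉ S, σ v ≠ τ v) → A σ τ = 0)

/-- The trace norm (Schatten 1-norm) `tr (A† A)^{1/2}`: the sum of the singular values. -/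
def traceNorm {n : Type*} [Fintype n] [DecidableEq n] (A : Matrix n n ℂ) : ℝ :=
  ∑ i, √((Matrix.isHermitian_conjTranspose_mul_self A).eigenvalues i)

/-- A set of edges is connected: any two of its edges are joined by a chain of its edges in which
consecutive ones share a vertex. -/
def EdgeConnected (I : Set (Sym2 V)) : Prop :=
  ∀ e ∈ I, ∀ f ∈ I,
    Relation.ReflTransGen (fun a b : Sym2 V => b ∈ I ∧ ∃ v, v ∈ a ∧ v ∈ b) e f

/-- The lattice growth constant of `G` is at most `γ`: each edge lies in at most `γ ^ l` connected
sets of `l` edges. -/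
def LatticeGrowthLE (G : SimpleGraph V) (γ : ℝ) : Prop :=
  ∀ e ∈ G.edgeSet, ∀ l : ℕ, 1 ≤ l →
    ({I : Finset (Sym2 V) | (I : Set (Sym2 V)) ⊆ G.edgeSet ∧ EdgeConnected (I : Set (Sym2 V)) ∧
      e ∈ I ∧ I.card = l}.ncard : ℝ) ≤ γ ^ l

variable (G : SimpleGraph V) [DecidableRel G.Adj]

/-- The interaction `h` assigns to every edge a Hermitian operator of norm at most one that acts
on the two ends of the edge only. -/
def IsInteraction (h : G.edgeSet → Op V d) : Prop :=
  ∀ e, (h e).IsHermitian ∧ ActsOn {v | v ∈ (e : Sym2 V)} (h e) ∧ ‖h e‖ ≤ 1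

variable {G}

/-- The Hamiltonian `H = ∑_e h_e`. -/
def hamiltonian (h : G.edgeSet → Op V d) : Op V d := ∑ e, h e

theorem isHermitian_hamiltonian {h : G.edgeSet → Op V d} (hh : IsInteraction G h) :
    (hamiltonian h).IsHermitian := by
  unfold hamiltonian Matrix.IsHermitian
  rw [Matrix.conjTranspose_sum]
  exact Finset.sum_congr rfl fun e _ => (hh e).1

/-- The unnormalised Gibbs operator `e^{-βH}`. -/
def gibbs (β : ℝ) (h : G.edgeSet → Op V d) : Op V d :=
  NormedSpace.exp (((-β : ℝ) : ℂ) • hamiltonian h)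

/-- The `2K` columns of one Trotter step `τ†τ`, where `τ = ∏_{i=1}^K e^{-βh_i/2M}`: the columns
`1, …, K` carry the interaction terms in decreasing order, the columns `K+1, …, 2K` in increasing
order. -/
def column (K : ℕ) : Fin (K + K) → Fin K := Fin.addCases Fin.rev id

/-- `x_i = e^{-β h̃_i / 2M} - 1`, where `h̃_i` is the interaction term of column `i`. -/
def trotterTerm {K : ℕ} (ord : Fin K ≃ G.edgeSet) (h : G.edgeSet → Op V d) (β : ℝ) (M : ℕ)
    (i : Fin (K + K)) : Op V d :=
  NormedSpace.exp (((-(β / (2 * M)) : ℝ) : ℂ) • h (ord (column K i))) - 1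

/-- The truncated Trotter expansion: the terms `∏_{j=1}^M ∏_{i=1}^{2K} x_i ^ λ_{ji}` of the
expanded product `(τ†τ)^M = ∏_{j=1}^M ∏_{i=1}^{2K} (1 + x_i)`, summed over the 0-1 tables `λ` with
at most `L` ones in each column. The products are ordered, row by row, from left to right. -/
def truncatedTrotter {K : ℕ} (ord : Fin K ≃ G.edgeSet) (h : G.edgeSet → Op V d) (β : ℝ)
    (M L : ℕ) : Op V d :=
  ∑ t : Fin M → Fin (K + K) → Fin 2 with ∀ i, ∑ j, (t j i : ℕ) ≤ L,
    ((List.finRange M).map fun j =>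
      ((List.finRange (K + K)).map fun i =>
        trotterTerm ord h β M i ^ (t j i : ℕ)).prod).prod

/-- `A` has a decomposition `∑_{ν=1}^s A_ν ⊗ B_ν` into `s` products of one-site operators at the
two ends of the edge `e`. -/
def SchmidtRankLE (e : Sym2 V) (s : ℕ) (A : Op V d) : Prop :=
  ∃ v w : V, e = s(v, w) ∧ ∃ a b : Fin s → Matrix (Fin d) (Fin d) ℂ,
    A = ∑ ν, siteTensor fun u => if u = v then a ν else if u = w then b ν else 1

variable (G)

/-- `ρ` is a PEPO on the graph `G` of bond dimension `D`:
`ρ = ∑_{α : E → {1,…,D}} ⨂_v X^v_{α(e) : e ∋ v}`. -/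
def IsPEPO (D : ℕ) (ρ : Op V d) : Prop :=
  ∃ X : (v : V) → ({e : G.edgeSet // v ∈ (e : Sym2 V)} → Fin D) → Matrix (Fin d) (Fin d) ℂ,
    ρ = ∑ α : G.edgeSet → Fin D, siteTensor fun v => X v fun e => α e.1

/-- The vector `Φ` is a PEPS on the graph `G` of bond dimension `D`. -/
def IsPEPS (D : ℕ) (Φ : (V → Fin d) → ℂ) : Prop :=
  ∃ T : (v : V) → ({e : G.edgeSet // v ∈ (e : Sym2 V)} → Fin D) → Fin d → ℂ,
    Φ = fun σ => ∑ α : G.edgeSet → Fin D, ∏ v, T v (fun e => α e.1) (σ v)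

variable {G}

/-- `Ψ` is a normalised ground state of `A`, with energy `E₀`, and every other energy level
(the spectrum on the orthogonal complement of `Ψ`) is at least `E₀ + Δ`. -/
def IsGappedGroundState (A : Op V d) (Ψ : (V → Fin d) → ℂ) (E₀ Δ : ℝ) : Prop :=
  star Ψ ⬝ᵥ Ψ = 1 ∧ A *ᵥ Ψ = (E₀ : ℂ) • Ψ ∧
    ∀ (φ : (V → Fin d) → ℂ) (E : ℝ), φ ≠ 0 → star Ψ ⬝ᵥ φ = 0 → A *ᵥ φ = (E : ℂ) • φ → E₀ + Δ ≤ E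

/-- The number of eigenvalues, counted with multiplicity, that are at most `E`. -/
def levelCount {A : Op V d} (hA : A.IsHermitian) (E : ℝ) : ℕ :=
  (Finset.univ.filter fun i => hA.eigenvalues i ≤ E).card

end

end GibbsPEPO

/-! Write `t = β/M`, let `m = 2K` be the number of columns and `g_i` the interaction term of column
`i`, so that `∑ g_i = 2H`. The error of the truncation is controlled by inclusion-exclusion over the
set `S` of heavy columns, those with more than `L` ones (`sum_light_eq`). For fixed `S`, the columns
outside `S` are summed freely, which restores their exponentials `1 + x_i = e^{-t g_i/2}`; only the
entries in `S` stay prescribed. The term `S = ∅` is the full Trotter product, and each other term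
must be small relative to `‖e^{-βH}‖_1`.

The relative bound comes from Hölder's inequality. If every row is written `R_j = Y_j A` with `A =
e^{-tH}`, then `‖∏ R_j‖_1 ≤ ∏ ‖Y_j‖ · tr A^M`, and `tr A^M` is the partition function itself
(`traceNorm_prod_rows_le`). Taking `M` a power of two makes iterated Cauchy-Schwarz sufficient. A
row without ones in `S` has `‖Y_j‖ ≤ 1 + t|S|/2 + (tm)^2`, because the first-order terms cancel
except on `S`; each one in `S` costs a further factor `3t` (`norm_prod_rowFactor_mul_exp_le`). Over
`M` rows the removed columns therefore cost only `e^{β|S|/2}`, with no factor exponential in the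
system size.

A Chernoff bound on the number of ones gives `e^{(10β-L)|S|}` for the term of `S`, and summing over
`S` gives `(1 + e^{10β-L})^m - 1`. Hence `L` of order `β + log(K/ε)` suffices, while `M` polynomial
in `K/ε` handles the Trotter error.

The truncation condition is imposed column by column, so the sum over tables is a sum over
independent column labels. A label chooses at most `L` of the `M` rows and one of `s` product terms
in each, and every edge carries two columns; this is the PEPO, with bond dimension at most `(L
(sM)^L)^2`.

For ground states, take `β` of order `log(N/ε)`. The gap and the level count make the excited weight
of `e^{-β(H-E₀)}` a geometric series, so the rescaled truncation approximates `|Ψ⟩⟨Ψ|`, and a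
suitably rescaled column of it approximates `Ψ`. -/

namespace GibbsPEPO

noncomputable section

/-! ### Schatten norms of dyadic order and Hölder's inequality. -/

section Schatten

open scoped ComplexOrder MatrixOrder

variable {n : Type*} [Fintype n]

theorem trace_conjTranspose_mul_self_eq (X : Matrix n n ℂ) :
    (Xᴴ * X).trace = ((∑ i, ∑ j, ‖X i j‖ ^ 2 : ℝ) : ℂ) := by
  simp only [Matrix.trace, Matrix.diag, Matrix.mul_apply, Matrix.conjTranspose_apply]
  rw [Finset.sum_comm]
  push_cast
  refine Finset.sum_congr rfl fun i _ => Finset.sum_congr rfl fun j _ => ?_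
  rw [Complex.star_def, mul_comm, Complex.mul_conj, Complex.normSq_eq_norm_sq]
  push_cast; rfl

theorem trace_re_nonneg_of_posSemidef {X : Matrix n n ℂ} (hX : X.PosSemidef) : 0 ≤ X.trace.re :=
  (Complex.nonneg_iff.1 hX.trace_nonneg).1

variable [DecidableEq n]

/-- `tr (X† X)^{2^k}`, a power of a Schatten norm of `X`. -/
def schattenPow (k : ℕ) (X : Matrix n n ℂ) : ℝ := ((Xᴴ * X) ^ 2 ^ k).trace.re

/-- The Schatten norm of order `2^(k+1)`. -/
def schattenNorm (k : ℕ) (X : Matrix n n ℂ) : ℝ := schattenPow k X ^ (((2 ^ (k + 1) : ℕ) : ℝ)⁻¹)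

theorem schattenPow_nonneg (k : ℕ) (X : Matrix n n ℂ) : 0 ≤ schattenPow k X :=
  trace_re_nonneg_of_posSemidef ((Matrix.posSemidef_conjTranspose_mul_self X).pow _)

theorem schattenNorm_nonneg (k : ℕ) (X : Matrix n n ℂ) : 0 ≤ schattenNorm k X :=
  Real.rpow_nonneg (schattenPow_nonneg k X) _

theorem schattenNorm_pow (k : ℕ) (X : Matrix n n ℂ) :
    schattenNorm k X ^ 2 ^ (k + 1) = schattenPow k X :=
  Real.rpow_inv_natCast_pow (schattenPow_nonneg k X) (by positivity)

/-- Cauchy-Schwarz for the Hilbert-Schmidt inner product, the base case of the dyadic Hölder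
inequality. -/
theorem norm_trace_mul_le (X Y : Matrix n n ℂ) :
    ‖(X * Y).trace‖ ≤ schattenNorm 0 X * schattenNorm 0 Y := by
  have h0 : ∀ Z : Matrix n n ℂ, schattenPow 0 Z = ∑ i, ∑ j, ‖Z i j‖ ^ 2 := fun Z => by
    rw [schattenPow, pow_zero, pow_one, trace_conjTranspose_mul_self_eq, Complex.ofReal_re]
  refine le_of_pow_le_pow_left₀ two_ne_zero
    (mul_nonneg (schattenNorm_nonneg _ _) (schattenNorm_nonneg _ _)) ?_
  have hX := schattenNorm_pow 0 X
  have hY := schattenNorm_pow 0 Y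
  simp only [zero_add, pow_one] at hX hY
  rw [mul_pow, hX, hY, h0, h0]
  have h1 : ‖(X * Y).trace‖ ≤ ∑ p : n × n, ‖X p.1 p.2‖ * ‖Y p.2 p.1‖ := by
    rw [Fintype.sum_prod_type]
    simp only [Matrix.trace, Matrix.diag, Matrix.mul_apply]
    refine (norm_sum_le _ _).trans (Finset.sum_le_sum fun i _ => (norm_sum_le _ _).trans
      (Finset.sum_le_sum fun j _ => (norm_mul_le _ _)))
  refine (pow_le_pow_left₀ (norm_nonneg _) h1 2).trans
    ((Finset.sum_mul_sq_le_sq_mul_sq _ _ _).trans (le_of_eq ?_))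
  congr 1
  · rw [Fintype.sum_prod_type]
  · rw [Fintype.sum_prod_type, Finset.sum_comm]

theorem trace_mul_pow_comm (X Y : Matrix n n ℂ) (m : ℕ) :
    ((X * Y) ^ m).trace = ((Y * X) ^ m).trace := by
  cases m with
  | zero => simp
  | succ m =>
    have h : (X * Y) ^ (m + 1) = X * ((Y * X) ^ m * Y) := by
      induction m with
      | zero => simp
      | succ m ih => rw [pow_succ, ih, pow_succ]; simp only [mul_assoc]
    rw [h, Matrix.trace_mul_comm, pow_succ, mul_assoc]

/-- Hölder's inequality for the trace of a product of `2^(k+1)` matrices. -/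
def TraceHolder (n : Type*) [Fintype n] [DecidableEq n] (k : ℕ) : Prop :=
  ∀ l : List (Matrix n n ℂ), l.length = 2 ^ (k + 1) →
    ‖l.prod.trace‖ ≤ (l.map (schattenNorm k)).prod

theorem schattenPow_of_isHermitian {P : Matrix n n ℂ} (hP : P.IsHermitian) (k : ℕ) :
    schattenPow k P = (P ^ 2 ^ (k + 1)).trace.re := by
  rw [schattenPow, hP.eq, ← sq, ← pow_mul, pow_succ' 2 k]

/-- By cyclicity the power of `‖XY‖` is `tr (PQ)^{2^k}` with `P = X†X` and `Q = YY†`. Hölder at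
level `k`, applied to the alternating word `P, Q, P, Q, …`, bounds it, and the norms of `P` and `Q`
are squares of norms of `X` and `Y` at level `k + 1`. -/
theorem schattenNorm_mul_le {k : ℕ} (hk : TraceHolder n k) (X Y : Matrix n n ℂ) :
    schattenNorm k (X * Y) ≤ schattenNorm (k + 1) X * schattenNorm (k + 1) Y := by
  set P := Xᴴ * X with hP
  set Q := Y * Yᴴ with hQ
  have hPh : P.IsHermitian := Matrix.isHermitian_conjTranspose_mul_self X
  have hQh : Q.IsHermitian := Matrix.isHermitian_mul_conjTranspose_self Y
  have e1 : schattenPow k (X * Y) = ((P * Q) ^ 2 ^ k).trace.re := by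
    rw [schattenPow, Matrix.conjTranspose_mul,
      show Yᴴ * Xᴴ * (X * Y) = Yᴴ * (P * Y) by rw [hP]; simp only [mul_assoc], trace_mul_pow_comm,
      hQ, mul_assoc]
  have aux : ∀ {a b : ℝ} (ha : 0 ≤ a) (hb : 0 ≤ b), a ^ 2 ^ (k + 1) = b ^ 2 ^ (k + 2) →
      a = b ^ 2 := fun {a b} ha hb h => by
    rw [pow_succ' 2 (k + 1), pow_mul] at h
    exact (pow_left_inj₀ ha (sq_nonneg b) (by positivity)).1 h
  have eP : schattenNorm k P = schattenNorm (k + 1) X ^ 2 :=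
    aux (schattenNorm_nonneg _ _) (schattenNorm_nonneg _ _) (by
      rw [schattenNorm_pow, schattenNorm_pow, schattenPow_of_isHermitian hPh]; rfl)
  have eQ : schattenNorm k Q = schattenNorm (k + 1) Y ^ 2 :=
    aux (schattenNorm_nonneg _ _) (schattenNorm_nonneg _ _) (by
      rw [schattenNorm_pow, schattenNorm_pow, schattenPow_of_isHermitian hQh, hQ,
        trace_mul_pow_comm]; rfl)
  have key := hk (List.replicate (2 ^ k) [P, Q]).flatten (by simp [pow_succ])
  have e2 : (List.replicate (2 ^ k) [P, Q]).flatten.prod = (P * Q) ^ 2 ^ k := by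
    rw [List.prod_flatten]; simp
  have e3 : ((List.replicate (2 ^ k) [P, Q]).flatten.map (schattenNorm k)).prod
      = (schattenNorm k P * schattenNorm k Q) ^ 2 ^ k := by
    rw [List.map_flatten, List.prod_flatten]; simp
  rw [e2, e3] at key
  refine le_of_pow_le_pow_left₀ (n := 2 ^ (k + 1)) (by positivity)
    (mul_nonneg (schattenNorm_nonneg _ _) (schattenNorm_nonneg _ _)) ?_
  rw [schattenNorm_pow, e1]
  refine ((Complex.re_le_norm _).trans key).trans (le_of_eq ?_)
  rw [eP, eQ, pow_succ' 2 k, pow_mul, mul_pow (schattenNorm _ _)]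

theorem exists_paired_list {k : ℕ} (hk : TraceHolder n k) (m : ℕ) (l : List (Matrix n n ℂ))
    (hl : l.length = 2 * m) : ∃ l' : List (Matrix n n ℂ), l'.length = m ∧ l'.prod = l.prod ∧
      (l'.map (schattenNorm k)).prod ≤ (l.map (schattenNorm (k + 1))).prod := by
  induction m generalizing l with
  | zero => exact ⟨[], rfl, by simp [List.length_eq_zero_iff.1 hl],
      by simp [List.length_eq_zero_iff.1 hl]⟩
  | succ m ih =>
    match l, hl with
    | X :: Y :: l, hl =>
      obtain ⟨l', h1, h2, h3⟩ := ih l (by simp at hl; omega)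
      refine ⟨(X * Y) :: l', by simp [h1], by simp [h2, mul_assoc], ?_⟩
      simp only [List.map_cons, List.prod_cons, ← mul_assoc]
      refine mul_le_mul (schattenNorm_mul_le hk X Y) h3 (List.prod_nonneg ?_)
        (mul_nonneg (schattenNorm_nonneg _ _) (schattenNorm_nonneg _ _))
      intro a ha
      obtain ⟨b, -, rfl⟩ := List.mem_map.1 ha
      exact schattenNorm_nonneg _ _

/-- Doubling: adjacent factors are multiplied together, which halves the length of the word, and
`schattenNorm_mul_le` splits the norm of each pair. -/
theorem traceHolder (k : ℕ) : TraceHolder n k := by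
  induction k with
  | zero =>
    intro l hl
    match l, hl with
    | [X, Y], _ => simpa using norm_trace_mul_le X Y
  | succ k ih =>
    intro l hl
    obtain ⟨l', h1, h2, h3⟩ := exists_paired_list ih (2 ^ (k + 1)) l (by rw [hl]; ring)
    rw [← h2]
    exact (ih l' h1).trans h3

theorem trace_mul_re_nonneg {X Y : Matrix n n ℂ} (hX : X.PosSemidef) (hY : Y.PosSemidef) :
    0 ≤ (X * Y).trace.re := by
  obtain ⟨B, rfl⟩ := CStarAlgebra.nonneg_iff_eq_star_mul_self.1 (Matrix.nonneg_iff_posSemidef.2 hX)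
  rw [mul_assoc, Matrix.trace_mul_comm]
  exact trace_re_nonneg_of_posSemidef (hY.mul_mul_conjTranspose_same B)

/-- Powers are not operator monotone in general, but their traces are: `tr X^p ≤ tr (X^{p-1} Z) ≤
‖X‖_p^{p-1} ‖Z‖_p` by Hölder, and `‖X‖_p^{p-1}` cancels unless it vanishes. -/
theorem trace_pow_le_trace_pow {k : ℕ} {X Z : Matrix n n ℂ} (hX : X.PosSemidef)
    (hXZ : (Z - X).PosSemidef) : (X ^ 2 ^ k).trace.re ≤ (Z ^ 2 ^ k).trace.re := by
  cases k with
  | zero =>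
    have := trace_re_nonneg_of_posSemidef hXZ
    simp only [Matrix.trace_sub, Complex.sub_re] at this
    simpa using this
  | succ k =>
    have hZ : Z.PosSemidef := by simpa using hXZ.add hX
    obtain ⟨q, hq⟩ : ∃ q, 2 ^ (k + 1) = q + 1 := ⟨2 ^ (k + 1) - 1, by
      have : 0 < 2 ^ (k + 1) := by positivity
      omega⟩
    have h1 : (X ^ 2 ^ (k + 1)).trace.re ≤ (X ^ q * Z).trace.re := by
      have := trace_mul_re_nonneg (hX.pow q) hXZ
      rw [mul_sub, Matrix.trace_sub, Complex.sub_re] at this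
      rw [hq, pow_succ]; linarith
    have h2 := traceHolder k (List.replicate q X ++ [Z]) (by simp [hq])
    simp only [List.prod_append, List.prod_replicate, List.prod_cons, List.prod_nil, mul_one,
      List.map_append, List.map_replicate, List.map_cons, List.map_nil] at h2
    rw [← schattenPow_of_isHermitian hX.1, ← schattenPow_of_isHermitian hZ.1,
      ← schattenNorm_pow, ← schattenNorm_pow] at *
    have h3 := h1.trans ((Complex.re_le_norm _).trans h2)
    have hx := schattenNorm_nonneg k X
    refine pow_le_pow_left₀ hx ?_ _
    rcases hx.eq_or_lt with h0 | h0
    · rw [← h0]; exact schattenNorm_nonneg _ _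
    · rw [hq, pow_succ] at h3
      exact le_of_mul_le_mul_left h3 (by positivity)

theorem posSemidef_sq_norm_sub (Y : Matrix n n ℂ) :
    (((‖Y‖ ^ 2 : ℝ) : ℂ) • (1 : Matrix n n ℂ) - Yᴴ * Y).PosSemidef := by
  refine Matrix.PosSemidef.of_dotProduct_mulVec_nonneg ?_ fun x => ?_
  · refine Matrix.IsHermitian.sub ?_ (Matrix.isHermitian_conjTranspose_mul_self Y)
    simp [Matrix.IsHermitian, Matrix.conjTranspose_smul]
  · have hn : ∀ y : n → ℂ, star y ⬝ᵥ y = ((‖WithLp.toLp 2 y‖ ^ 2 : ℝ) : ℂ) := fun y => by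
      rw [EuclideanSpace.norm_sq_eq]
      push_cast
      refine Finset.sum_congr rfl fun i _ => ?_
      simp only [Pi.star_apply, Complex.star_def]
      rw [mul_comm, Complex.mul_conj, Complex.normSq_eq_norm_sq]; push_cast; rfl
    rw [Matrix.sub_mulVec, dotProduct_sub, Matrix.smul_mulVec, Matrix.one_mulVec, dotProduct_smul,
      ← Matrix.mulVec_mulVec, Matrix.dotProduct_mulVec, ← Matrix.star_mulVec, hn, hn,
      smul_eq_mul, ← Complex.ofReal_mul, ← Complex.ofReal_sub, Complex.nonneg_iff]
    refine ⟨?_, (Complex.ofReal_im _).symm⟩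
    rw [Complex.ofReal_re, sub_nonneg, ← mul_pow]
    exact pow_le_pow_left₀ (norm_nonneg _) (Matrix.l2_opNorm_mulVec Y (WithLp.toLp 2 x)) 2

/-- Trace monotonicity applied to `(YA)†(YA) ≤ ‖Y‖² A†A`. -/
theorem schattenNorm_mul_le_norm_mul (k : ℕ) (A Y : Matrix n n ℂ) :
    schattenNorm k (Y * A) ≤ ‖Y‖ * schattenNorm k A := by
  refine le_of_pow_le_pow_left₀ (n := 2 ^ (k + 1)) (by positivity)
    (mul_nonneg (norm_nonneg _) (schattenNorm_nonneg _ _)) ?_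
  rw [mul_pow, schattenNorm_pow, schattenNorm_pow]
  have h : ((((‖Y‖ ^ 2 : ℝ) : ℂ) • (Aᴴ * A)) - (Y * A)ᴴ * (Y * A)).PosSemidef := by
    have := (posSemidef_sq_norm_sub Y).conjTranspose_mul_mul_same A
    convert this using 1
    rw [mul_sub, sub_mul, Matrix.conjTranspose_mul]
    simp only [Matrix.mul_smul, Matrix.smul_mul, mul_one, mul_assoc]
  have := trace_pow_le_trace_pow (k := k) (Matrix.posSemidef_conjTranspose_mul_self (Y * A)) h
  refine this.trans (le_of_eq ?_)
  rw [smul_pow, Matrix.trace_smul, smul_eq_mul, ← Complex.ofReal_pow, Complex.re_ofReal_mul,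
    schattenPow, pow_succ' 2 k, pow_mul]

/-- `|tr ∏_j (Y_j A)| ≤ tr A^p ∏_j ‖Y_j‖` for `A ≥ 0` and a power of two `p ≥ 2`. -/
theorem norm_trace_prod_mul_le (k : ℕ) {A : Matrix n n ℂ} (hA : A.PosSemidef)
    (l : List (Matrix n n ℂ)) (hl : l.length = 2 ^ (k + 1)) :
    ‖(l.map (· * A)).prod.trace‖ ≤ (l.map norm).prod * (A ^ 2 ^ (k + 1)).trace.re := by
  refine (traceHolder k _ (by simpa using hl)).trans ?_
  rw [← schattenPow_of_isHermitian hA.1, ← schattenNorm_pow, ← hl]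
  clear hl
  rw [List.map_map]
  induction l with
  | nil => simp
  | cons Y l ih =>
    simp only [List.map_cons, List.prod_cons, List.length_cons, pow_succ', Function.comp]
    calc _ ≤ (‖Y‖ * schattenNorm k A) * ((l.map norm).prod * schattenNorm k A ^ l.length) :=
          mul_le_mul (schattenNorm_mul_le_norm_mul k A Y) ih (List.prod_nonneg ?_)
            (mul_nonneg (norm_nonneg _) (schattenNorm_nonneg _ _))
      _ = _ := by ring
    intro a ha
    obtain ⟨b, -, rfl⟩ := List.mem_map.1 ha
    exact schattenNorm_nonneg _ _

end Schatten

/-! ### The trace norm and its duality with the operator norm. -/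

section TraceNorm

open scoped ComplexOrder MatrixOrder

variable {n : Type*} [Fintype n] [DecidableEq n]

/-- The trace is evaluated in an eigenbasis `b_i` of `A†A`, where `‖A b_i‖` is the `i`-th singular
value. -/
theorem norm_trace_mul_le_traceNorm {X : Matrix n n ℂ} (hX : ‖X‖ ≤ 1) (A : Matrix n n ℂ) :
    ‖(X * A).trace‖ ≤ traceNorm A := by
  set hA := Matrix.isHermitian_conjTranspose_mul_self A
  set b := hA.eigenvectorBasis
  have htr : (X * A).trace = ∑ i, inner ℂ (b i) (Matrix.toEuclideanLin (X * A) (b i)) := by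
    rw [← LinearMap.trace_eq_sum_inner, Matrix.toEuclideanLin_eq_toLin_orthonormal,
      Matrix.trace_toLin_eq]
  rw [htr, traceNorm]
  refine (norm_sum_le _ _).trans (Finset.sum_le_sum fun i _ => ?_)
  refine (norm_inner_le_norm _ _).trans ?_
  rw [b.norm_eq_one, one_mul]
  have h1 : Matrix.toEuclideanLin (X * A) (b i) = WithLp.toLp 2 (X *ᵥ (A *ᵥ (b i).ofLp)) := by
    rw [Matrix.mulVec_mulVec]; rfl
  have h2 : ‖WithLp.toLp 2 (A *ᵥ (b i).ofLp)‖ = √(hA.eigenvalues i) := by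
    rw [eq_comm, Real.sqrt_eq_iff_eq_sq (Matrix.eigenvalues_conjTranspose_mul_self_nonneg A i)
      (norm_nonneg _), hA.eigenvalues_eq, ← Matrix.mulVec_mulVec, Matrix.dotProduct_mulVec,
      ← Matrix.star_mulVec, EuclideanSpace.norm_sq_eq]
    simp only [dotProduct, Pi.star_apply, map_sum]
    refine Finset.sum_congr rfl fun j _ => ?_
    rw [mul_comm]
    simp only [RCLike.star_def, RCLike.mul_conj]
    norm_cast
  rw [h1]
  calc _ ≤ ‖X‖ * ‖WithLp.toLp 2 (A *ᵥ (b i).ofLp)‖ :=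
        Matrix.l2_opNorm_mulVec X (WithLp.toLp 2 (A *ᵥ (b i).ofLp))
    _ ≤ 1 * _ := mul_le_mul_of_nonneg_right hX (norm_nonneg _)
    _ = _ := by rw [one_mul, h2]

/-- An inequality, since the index type may be empty and the norm then zero. -/
theorem norm_one_le_one : ‖(1 : Matrix n n ℂ)‖ ≤ 1 := by
  rw [← Matrix.diagonal_one, Matrix.l2_opNorm_diagonal]
  exact (pi_norm_le_iff_of_nonneg zero_le_one).2 fun i => by simp

/-- The polar decomposition supplies the optimal test operator `(A†A)^{-1/2} A†`. -/
theorem exists_trace_mul_eq_traceNorm (A : Matrix n n ℂ) :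
    ∃ U : Matrix n n ℂ, ‖U‖ ≤ 1 ∧ (U * A).trace = traceNorm A := by
  set hA := Matrix.isHermitian_conjTranspose_mul_self A
  set V : Matrix n n ℂ := (hA.eigenvectorUnitary).1
  set s : n → ℝ := fun i => √(hA.eigenvalues i)
  have hs : ∀ i, hA.eigenvalues i = s i * s i := fun i =>
    (Real.mul_self_sqrt (Matrix.eigenvalues_conjTranspose_mul_self_nonneg A i)).symm
  have hspec : Aᴴ * A = V * Matrix.diagonal (fun i => ((s i * s i : ℝ) : ℂ)) * Vᴴ := by
    conv_lhs => rw [hA.spectral_theorem, Unitary.conjStarAlgAut_apply]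
    simp only [← hs]
    rfl
  have hV : Vᴴ * V = 1 := Unitary.coe_star_mul_self hA.eigenvectorUnitary
  have hV1 : ‖V‖ ≤ 1 := by
    have := Matrix.l2_opNorm_conjTranspose_mul_self V
    rw [hV] at this
    nlinarith [norm_nonneg V, norm_one_le_one (n := n)]
  -- The convention `0⁻¹ = 0` makes this the pseudo-inverse of `(A†A)^{1/2}`, so `A` need not be
  -- invertible.
  set W : Matrix n n ℂ := V * Matrix.diagonal (fun i => (((s i)⁻¹ : ℝ) : ℂ)) * Vᴴ
  have hW : Wᴴ = W := by
    simp only [W, Matrix.conjTranspose_mul, Matrix.conjTranspose_conjTranspose,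
      Matrix.diagonal_conjTranspose, mul_assoc]
    congr 3
    ext i
    simp
  have hmul : ∀ (a b : n → ℂ), (V * Matrix.diagonal a * Vᴴ) * (V * Matrix.diagonal b * Vᴴ) =
      V * Matrix.diagonal (fun i => a i * b i) * Vᴴ := fun a b => by
    rw [← Matrix.diagonal_mul_diagonal]
    calc _ = V * Matrix.diagonal a * (Vᴴ * V) * Matrix.diagonal b * Vᴴ := by
          simp only [mul_assoc]
      _ = _ := by rw [hV]; simp only [mul_assoc, one_mul]
  refine ⟨W * Aᴴ, ?_, ?_⟩
  · have h1 : ‖(W * Aᴴ)ᴴᴴ * (W * Aᴴ)ᴴ‖ ≤ 1 := by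
      rw [Matrix.conjTranspose_conjTranspose, Matrix.conjTranspose_mul, hW,
        Matrix.conjTranspose_conjTranspose, show W * Aᴴ * (A * W) = W * (Aᴴ * A) * W by
          simp only [mul_assoc], hspec, hmul, hmul]
      refine (norm_mul_le _ _).trans (mul_le_one₀ ((norm_mul_le _ _).trans
        (mul_le_one₀ hV1 (norm_nonneg _) ?_)) (norm_nonneg _) ?_)
      · rw [Matrix.l2_opNorm_diagonal]
        refine (pi_norm_le_iff_of_nonneg zero_le_one).2 fun i => ?_
        rw [← Complex.ofReal_mul, ← Complex.ofReal_mul, Complex.norm_real]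
        rcases eq_or_ne (s i) 0 with h | h
        · simp [h]
        · field_simp; simp
      · rwa [Matrix.l2_opNorm_conjTranspose]
    rw [Matrix.l2_opNorm_conjTranspose_mul_self, Matrix.l2_opNorm_conjTranspose] at h1
    nlinarith [norm_nonneg (W * Aᴴ)]
  · rw [mul_assoc, hspec, hmul, Matrix.trace_mul_comm, ← mul_assoc, hV, one_mul,
      Matrix.trace_diagonal, traceNorm, Complex.ofReal_sum]
    refine Finset.sum_congr rfl fun i _ => ?_
    change _ = ((s i : ℝ) : ℂ)
    rw [← Complex.ofReal_mul]
    congr 1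
    rcases eq_or_ne (s i) 0 with h | h
    · simp [h]
    · field_simp

theorem traceNorm_le_of_forall {A : Matrix n n ℂ} {c : ℝ}
    (h : ∀ U : Matrix n n ℂ, ‖U‖ ≤ 1 → ‖(U * A).trace‖ ≤ c) : traceNorm A ≤ c := by
  obtain ⟨U, hU, hUA⟩ := exists_trace_mul_eq_traceNorm A
  have := h U hU
  rw [hUA, Complex.norm_real] at this
  exact (le_abs_self _).trans this

theorem traceNorm_nonneg (A : Matrix n n ℂ) : 0 ≤ traceNorm A :=
  Finset.sum_nonneg fun _ _ => Real.sqrt_nonneg _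

theorem traceNorm_zero : traceNorm (0 : Matrix n n ℂ) = 0 :=
  le_antisymm (traceNorm_le_of_forall fun U _ => by simp) (traceNorm_nonneg _)

theorem traceNorm_add_le (A B : Matrix n n ℂ) : traceNorm (A + B) ≤ traceNorm A + traceNorm B :=
  traceNorm_le_of_forall fun U hU => by
    rw [mul_add, Matrix.trace_add]
    exact (norm_add_le _ _).trans
      (add_le_add (norm_trace_mul_le_traceNorm hU A) (norm_trace_mul_le_traceNorm hU B))

theorem traceNorm_smul_le (c : ℂ) (A : Matrix n n ℂ) : traceNorm (c • A) ≤ ‖c‖ * traceNorm A :=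
  traceNorm_le_of_forall fun U hU => by
    rw [Matrix.mul_smul, Matrix.trace_smul, norm_smul]
    exact mul_le_mul_of_nonneg_left (norm_trace_mul_le_traceNorm hU A) (norm_nonneg _)

theorem traceNorm_sub_le (A B : Matrix n n ℂ) : traceNorm (A - B) ≤ traceNorm A + traceNorm B := by
  rw [sub_eq_add_neg]
  refine (traceNorm_add_le _ _).trans (add_le_add_right ?_ _)
  simpa using traceNorm_smul_le (-1) B

theorem traceNorm_sum_le {ι : Type*} (s : Finset ι) (f : ι → Matrix n n ℂ) :
    traceNorm (∑ i ∈ s, f i) ≤ ∑ i ∈ s, traceNorm (f i) :=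
  Finset.le_sum_of_subadditive _ traceNorm_zero.le traceNorm_add_le s f

theorem trace_re_le_traceNorm (A : Matrix n n ℂ) : A.trace.re ≤ traceNorm A := by
  have := norm_trace_mul_le_traceNorm norm_one_le_one A
  rw [one_mul] at this
  exact (Complex.re_le_norm _).trans this

theorem sum_norm_sq_le_traceNorm_sq (A : Matrix n n ℂ) :
    ∑ i, ∑ j, ‖A i j‖ ^ 2 ≤ traceNorm A ^ 2 := by
  set hA := Matrix.isHermitian_conjTranspose_mul_self A
  have h1 : ∑ i, ∑ j, ‖A i j‖ ^ 2 = ∑ i, √(hA.eigenvalues i) ^ 2 := by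
    have h := trace_conjTranspose_mul_self_eq A
    rw [hA.trace_eq_sum_eigenvalues] at h
    have h' : ∑ i, hA.eigenvalues i = ∑ i, ∑ j, ‖A i j‖ ^ 2 :=
      Complex.ofReal_injective (by rw [← h, Complex.ofReal_sum]; rfl)
    rw [← h']
    exact Finset.sum_congr rfl fun i _ =>
      (Real.sq_sqrt (Matrix.eigenvalues_conjTranspose_mul_self_nonneg A i)).symm
  rw [h1]
  exact Finset.sum_sq_le_sq_sum_of_nonneg fun i _ => Real.sqrt_nonneg _

/-- By duality a test operator `U` appears in front of the product; it is absorbed into the first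
factor `Y`, which exists because the length is positive. -/
theorem traceNorm_prod_mul_le (k : ℕ) {A : Matrix n n ℂ} (hA : A.PosSemidef)
    (l : List (Matrix n n ℂ)) (hl : l.length = 2 ^ (k + 1)) :
    traceNorm (l.map (· * A)).prod ≤ (l.map norm).prod * traceNorm (A ^ 2 ^ (k + 1)) := by
  refine traceNorm_le_of_forall fun U hU => ?_
  have hnn : ∀ l : List (Matrix n n ℂ), 0 ≤ (l.map norm).prod := fun l => List.prod_nonneg (by
    intro a ha
    obtain ⟨b, -, rfl⟩ := List.mem_map.1 ha
    exact norm_nonneg _)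
  cases l with
  | nil => exact absurd hl (by positivity)
  | cons Y l =>
    have := norm_trace_prod_mul_le k hA ((U * Y) :: l) (by simpa using hl)
    simp only [List.map_cons, List.prod_cons] at this ⊢
    rw [← mul_assoc, ← mul_assoc]
    refine this.trans ?_
    refine mul_le_mul (mul_le_mul_of_nonneg_right ?_ (hnn l)) (trace_re_le_traceNorm _) ?_
      (mul_nonneg (norm_nonneg _) (hnn l))
    · exact (norm_mul_le _ _).trans (mul_le_of_le_one_left (norm_nonneg _) hU)
    · exact trace_re_nonneg_of_posSemidef (hA.pow _)

end TraceNorm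

/-! ### Norm estimates for one row of the Trotter product. -/

section Exponential

variable {n : Type*} [Fintype n] [DecidableEq n]

/-- The remainder of the series is dominated term by term by its scalar counterpart; orders `0`,
`1`, `2` are used below. -/
theorem norm_exp_sub_sum_le {a : Matrix n n ℂ} {r : ℝ} (h : ‖a‖ ≤ r) (k : ℕ) :
    ‖NormedSpace.exp a - ∑ i ∈ Finset.range k, ((i.factorial : ℂ)⁻¹) • a ^ i‖ ≤
      Real.exp r - ∑ i ∈ Finset.range k, ((i.factorial : ℝ)⁻¹) • r ^ i := by
  have h1 := (hasSum_nat_add_iff' k).2 (NormedSpace.exp_series_hasSum_exp' (𝕂 := ℂ) a)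
  have h2 := (hasSum_nat_add_iff' k).2 (NormedSpace.exp_series_hasSum_exp' (𝕂 := ℝ) r)
  rw [← Real.exp_eq_exp_ℝ] at h2
  refine h1.norm_le_of_bounded h2 fun i => ?_
  rw [norm_smul, norm_inv, Complex.norm_natCast, smul_eq_mul]
  refine mul_le_mul_of_nonneg_left ?_ (by positivity)
  have hpow : ∀ j, ‖a ^ j‖ ≤ ‖a‖ ^ j := fun j => by
    induction j with
    | zero => simpa using norm_one_le_one
    | succ j ih =>
      rw [pow_succ, pow_succ]
      exact (norm_mul_le _ _).trans (mul_le_mul_of_nonneg_right ih (norm_nonneg _))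
  exact (hpow _).trans (pow_le_pow_left₀ (norm_nonneg _) h _)

theorem norm_exp_le {a : Matrix n n ℂ} {r : ℝ} (h : ‖a‖ ≤ r) :
    ‖NormedSpace.exp a‖ ≤ Real.exp r := by
  simpa using norm_exp_sub_sum_le h 0

theorem norm_exp_sub_one_le {a : Matrix n n ℂ} {r : ℝ} (h : ‖a‖ ≤ r) :
    ‖NormedSpace.exp a - 1‖ ≤ Real.exp r - 1 := by
  simpa using norm_exp_sub_sum_le h 1

theorem norm_exp_sub_one_sub_le {a : Matrix n n ℂ} {r : ℝ} (h : ‖a‖ ≤ r) :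
    ‖NormedSpace.exp a - 1 - a‖ ≤ Real.exp r - 1 - r := by
  simpa [Finset.sum_range_succ, sub_sub] using norm_exp_sub_sum_le h 2

/-- A product of exponentials obeys the scalar Taylor bounds at the sum of the norms. The three
orders are proved together because the induction step for each uses the lower ones. -/
theorem norm_prod_exp_le (l : List (Matrix n n ℂ)) :
    ‖(l.map NormedSpace.exp).prod‖ ≤ Real.exp (l.map norm).sum ∧
    ‖(l.map NormedSpace.exp).prod - 1‖ ≤ Real.exp (l.map norm).sum - 1 ∧
    ‖(l.map NormedSpace.exp).prod - 1 - l.sum‖ ≤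
      Real.exp (l.map norm).sum - 1 - (l.map norm).sum := by
  induction l with
  | nil => simpa using norm_one_le_one
  | cons a l ih =>
    simp only [List.map_cons, List.prod_cons, List.sum_cons, Real.exp_add]
    set P := (l.map NormedSpace.exp).prod
    set R := (l.map norm).sum
    set e := NormedSpace.exp a
    obtain ⟨h1, h2, h3⟩ := ih
    have g1 : ‖e‖ ≤ Real.exp ‖a‖ := norm_exp_le le_rfl
    have g2 : ‖e - 1‖ ≤ Real.exp ‖a‖ - 1 := norm_exp_sub_one_le le_rfl
    have g3 : ‖e - 1 - a‖ ≤ Real.exp ‖a‖ - 1 - ‖a‖ := norm_exp_sub_one_sub_le le_rfl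
    refine ⟨(norm_mul_le _ _).trans (mul_le_mul g1 h1 (norm_nonneg _) (Real.exp_nonneg _)), ?_, ?_⟩
    · calc ‖e * P - 1‖ = ‖(e - 1) * P + (P - 1)‖ := by congr 1; noncomm_ring
        _ ≤ (Real.exp ‖a‖ - 1) * Real.exp R + (Real.exp R - 1) :=
          (norm_add_le _ _).trans (add_le_add ((norm_mul_le _ _).trans
            (mul_le_mul g2 h1 (norm_nonneg _) ((norm_nonneg _).trans g2))) h2)
        _ = _ := by ring
    · calc ‖e * P - 1 - (a + l.sum)‖ = ‖(e - 1 - a) * P + a * (P - 1) + (P - 1 - l.sum)‖ := by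
            congr 1; noncomm_ring
        _ ≤ (Real.exp ‖a‖ - 1 - ‖a‖) * Real.exp R + ‖a‖ * (Real.exp R - 1) +
            (Real.exp R - 1 - R) :=
          (norm_add_le _ _).trans (add_le_add ((norm_add_le _ _).trans (add_le_add
            ((norm_mul_le _ _).trans (mul_le_mul g3 h1 (norm_nonneg _) ((norm_nonneg _).trans g3)))
            ((norm_mul_le _ _).trans (mul_le_mul_of_nonneg_left h2 (norm_nonneg _))))) h3)
        _ = _ := by ring

theorem norm_list_prod_le (l : List (Matrix n n ℂ)) : ‖l.prod‖ ≤ (l.map norm).prod := by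
  induction l with
  | nil => simpa using norm_one_le_one
  | cons a l ih =>
    simp only [List.map_cons, List.prod_cons]
    exact (norm_mul_le _ _).trans (mul_le_mul_of_nonneg_left ih (norm_nonneg _))

theorem exp_sub_one_sub_le_sq {r s : ℝ} (h0 : 0 ≤ r) (hrs : r ≤ s) (hs : s ≤ 1) :
    Real.exp r - 1 - r ≤ s ^ 2 := by
  have := Real.norm_exp_sub_one_sub_id_le (x := r) (by
    rw [Real.norm_of_nonneg h0]; exact hrs.trans hs)
  rw [Real.norm_of_nonneg h0] at this
  exact (le_abs_self _).trans (this.trans (pow_le_pow_left₀ h0 hrs 2))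

/-- The factor that row `u` of a table contributes in column `i`: the columns outside `S` are
summed over. -/
def rowFactor {m : ℕ} (x : Fin m → Matrix n n ℂ) (S : Finset (Fin m)) (u : Fin m → Fin 2)
    (i : Fin m) : Matrix n n ℂ :=
  if i ∈ S then x i ^ (u i : ℕ) else 1 + x i

variable {m : ℕ} {g : Fin m → Matrix n n ℂ} {H : Matrix n n ℂ} {t : ℝ}

/-- Since `∑ g_i = 2H`, the first-order terms of the row and of `e^{tH}` cancel apart from the
removed columns. Treating `e^{tH}` as one more factor of the product leaves a second-order remainder
with total norm at most `tm/2 + tm/2`. -/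
theorem norm_prod_removed_sub_one_sub_le (hg : ∀ i, ‖g i‖ ≤ 1) (hH : ∑ i, g i = (2 : ℂ) • H)
    (ht : 0 ≤ t) (htm : t * m ≤ 1) (S : Finset (Fin m)) :
    ‖((List.finRange m).map fun i =>
        if i ∈ S then 1 else NormedSpace.exp (((-(t / 2) : ℝ) : ℂ) • g i)).prod *
        NormedSpace.exp ((t : ℂ) • H) - 1 - ((t / 2 : ℝ) : ℂ) • ∑ i ∈ S, g i‖ ≤ (t * m) ^ 2 := by
  set a : Fin m → Matrix n n ℂ := fun i => if i ∈ S then 0 else ((-(t / 2) : ℝ) : ℂ) • g i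
  have ha : ∀ i, ‖a i‖ ≤ t / 2 := fun i => by
    simp only [a]
    split_ifs
    · rw [norm_zero]; positivity
    · rw [norm_smul, Complex.norm_real, norm_neg, Real.norm_of_nonneg (by positivity)]
      exact mul_le_of_le_one_right (by positivity) (hg i)
  have hHn : ‖(t : ℂ) • H‖ ≤ t / 2 * m := by
    have : H = (2 : ℂ)⁻¹ • ∑ i, g i := by rw [hH, smul_smul]; simp
    rw [this, smul_smul, norm_smul]
    have h1 : ‖∑ i, g i‖ ≤ m := by
      refine (norm_sum_le _ _).trans ((Finset.sum_le_sum fun i _ => hg i).trans ?_)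
      simp
    have h2 : ‖(t : ℂ) * 2⁻¹‖ = t / 2 := by
      rw [norm_mul, Complex.norm_real, Real.norm_of_nonneg ht]; simp; ring
    rw [h2]
    exact mul_le_mul_of_nonneg_left h1 (by positivity)
  have key := (norm_prod_exp_le ((List.finRange m).map a ++ [(t : ℂ) • H])).2.2
  have hR0 : 0 ≤ (((List.finRange m).map a ++ [(t : ℂ) • H]).map norm).sum :=
    List.sum_nonneg (by
      intro b hb
      obtain ⟨c, -, rfl⟩ := List.mem_map.1 hb
      exact norm_nonneg _)
  have hR : (((List.finRange m).map a ++ [(t : ℂ) • H]).map norm).sum ≤ t * m := by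
    rw [List.map_append, List.sum_append, List.map_map, ← Fin.sum_univ_def]
    have : ∑ i, (norm ∘ a) i ≤ m * (t / 2) :=
      (Finset.sum_le_sum fun i _ => ha i).trans (by simp)
    simp only [List.map_cons, List.map_nil, List.sum_cons, List.sum_nil, add_zero]
    linarith
  have hexp : ∀ i, NormedSpace.exp (a i) =
      if i ∈ S then 1 else NormedSpace.exp (((-(t / 2) : ℝ) : ℂ) • g i) := fun i => by
    simp only [a]
    split_ifs
    · exact NormedSpace.exp_zero
    · rfl
  have hsum : ((List.finRange m).map a ++ [(t : ℂ) • H]).sum =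
      ((t / 2 : ℝ) : ℂ) • ∑ i ∈ S, g i := by
    rw [List.sum_append, ← Fin.sum_univ_def, List.sum_singleton]
    have h1 : (t : ℂ) • H = ((t / 2 : ℝ) : ℂ) • ∑ i, g i := by
      rw [hH, smul_smul]; congr 1; push_cast; ring
    rw [h1, ← Finset.sum_add_sum_compl S a, ← Finset.sum_add_sum_compl S g]
    have h2 : ∑ i ∈ S, a i = 0 := Finset.sum_eq_zero fun i hi => by simp [a, hi]
    have h3 : ∑ i ∈ Sᶜ, a i = -(((t / 2 : ℝ) : ℂ) • ∑ i ∈ Sᶜ, g i) := by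
      rw [Finset.smul_sum, ← Finset.sum_neg_distrib]
      refine Finset.sum_congr rfl fun i hi => ?_
      simp [a, Finset.mem_compl.1 hi]
    rw [h2, h3, smul_add]; abel
  rw [hsum, List.map_append, List.prod_append, List.map_map, List.map_singleton,
    List.prod_singleton] at key
  simp only [Function.comp_def, hexp] at key
  exact key.trans (exp_sub_one_sub_le_sq hR0 hR htm)

/-- Rows without ones in `S` need the sharp estimate, since nearly all `M` rows may be of this kind.
A row with a one in `S` can afford the crude factor `e^{tm} ≤ 3`, charged to that one; this turns
`t` into `3t`. -/
theorem norm_prod_rowFactor_mul_exp_le (hg : ∀ i, ‖g i‖ ≤ 1) (hH : ∑ i, g i = (2 : ℂ) • H)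
    (ht : 0 ≤ t) (htm : t * m ≤ 1) (S : Finset (Fin m)) (u : Fin m → Fin 2) :
    ‖((List.finRange m).map (rowFactor
        (fun i => NormedSpace.exp (((-(t / 2) : ℝ) : ℂ) • g i) - 1) S u)).prod *
        NormedSpace.exp ((t : ℂ) • H)‖ ≤
      (1 + t / 2 * S.card + (t * m) ^ 2) * ∏ i ∈ S, (3 * t) ^ (u i : ℕ) := by
  set x : Fin m → Matrix n n ℂ := fun i => NormedSpace.exp (((-(t / 2) : ℝ) : ℂ) • g i) - 1
  by_cases hu : ∀ i ∈ S, u i = 0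
  · have h1 : rowFactor x S u = fun i =>
        if i ∈ S then 1 else NormedSpace.exp (((-(t / 2) : ℝ) : ℂ) • g i) := by
      funext i
      simp only [rowFactor, x]
      split_ifs with hi
      · simp [hu i hi]
      · simp
    have h2 : ∏ i ∈ S, (3 * t) ^ (u i : ℕ) = 1 :=
      Finset.prod_eq_one fun i hi => by simp [hu i hi]
    rw [h1, h2, mul_one]
    have key := norm_prod_removed_sub_one_sub_le hg hH ht htm S
    set Z := ((List.finRange m).map fun i =>
        if i ∈ S then 1 else NormedSpace.exp (((-(t / 2) : ℝ) : ℂ) • g i)).prod *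
        NormedSpace.exp ((t : ℂ) • H)
    have h3 : ‖((t / 2 : ℝ) : ℂ) • ∑ i ∈ S, g i‖ ≤ t / 2 * S.card := by
      rw [norm_smul, Complex.norm_real, Real.norm_of_nonneg (by positivity)]
      refine mul_le_mul_of_nonneg_left ?_ (by positivity)
      refine (norm_sum_le _ _).trans ((Finset.sum_le_sum fun i _ => hg i).trans ?_)
      simp
    calc ‖Z‖ = ‖1 + ((t / 2 : ℝ) : ℂ) • ∑ i ∈ S, g i +
          (Z - 1 - ((t / 2 : ℝ) : ℂ) • ∑ i ∈ S, g i)‖ := by congr 1; abel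
      _ ≤ _ := (norm_add_le _ _).trans (add_le_add ((norm_add_le _ _).trans
          (add_le_add norm_one_le_one h3)) key)
  · push Not at hu
    obtain ⟨i₀, hi₀, hu₀⟩ := hu
    have hgn : ∀ i, ‖((-(t / 2) : ℝ) : ℂ) • g i‖ ≤ t / 2 := fun i => by
      rw [norm_smul, Complex.norm_real, norm_neg, Real.norm_of_nonneg (by positivity)]
      exact mul_le_of_le_one_right (by positivity) (hg i)
    set w : Fin m → ℝ := fun i => if i ∈ S then t ^ (u i : ℕ) else 1
    have hw : ∀ i, ‖rowFactor x S u i‖ ≤ Real.exp (t / 2) * w i := fun i => by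
      simp only [rowFactor, w]
      split_ifs with hi
      · have h01 : u i = 0 ∨ u i = 1 := by omega
        rcases h01 with h | h
        · simp only [h, Fin.val_zero, pow_zero, mul_one]
          exact norm_one_le_one.trans (Real.one_le_exp (by positivity))
        -- Here `e^{t/2} - 1 ≤ (t/2) e^{t/2} ≤ t e^{t/2}`.
        · simp only [h, Fin.val_one, pow_one]
          refine (norm_exp_sub_one_le (hgn i)).trans ?_
          have h1 := Real.add_one_le_exp (-(t / 2))
          have h2 : Real.exp (t / 2) * Real.exp (-(t / 2)) = 1 := by
            rw [← Real.exp_add]; simp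
          nlinarith [Real.exp_pos (t / 2)]
      · rw [mul_one, add_sub_cancel]
        exact norm_exp_le (hgn i)
    have hHn : ‖(t : ℂ) • H‖ ≤ t * m / 2 := by
      have : H = (2 : ℂ)⁻¹ • ∑ i, g i := by rw [hH, smul_smul]; simp
      rw [this, smul_smul, norm_smul]
      have h1 : ‖∑ i, g i‖ ≤ m := by
        refine (norm_sum_le _ _).trans ((Finset.sum_le_sum fun i _ => hg i).trans ?_)
        simp
      have h2 : ‖(t : ℂ) * 2⁻¹‖ = t / 2 := by
        rw [norm_mul, Complex.norm_real, Real.norm_of_nonneg ht]; simp; ring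
      rw [h2]
      nlinarith
    have hprod : ‖((List.finRange m).map (rowFactor x S u)).prod‖ ≤
        Real.exp (t * m / 2) * ∏ i ∈ S, t ^ (u i : ℕ) := by
      refine (norm_list_prod_le _).trans ?_
      rw [List.map_map, ← Fin.prod_univ_def]
      refine (Finset.prod_le_prod (fun i _ => norm_nonneg _) fun i _ => hw i).trans (le_of_eq ?_)
      rw [Finset.prod_mul_distrib, Finset.prod_const, Finset.card_univ, Fintype.card_fin,
        ← Real.exp_nat_mul, Finset.prod_ite_mem, Finset.univ_inter]
      congr 2; ring
    have h3 : (3 : ℝ) ≤ ∏ i ∈ S, (3 : ℝ) ^ (u i : ℕ) := by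
      rw [← Finset.mul_prod_erase S _ hi₀]
      have h1 : (u i₀ : ℕ) = 1 := by omega
      have h2 : (1 : ℝ) ≤ ∏ i ∈ S.erase i₀, (3 : ℝ) ^ (u i : ℕ) :=
        Finset.one_le_prod fun i _ => one_le_pow₀ (by norm_num)
      rw [h1]; linarith
    have hp : 0 ≤ ∏ i ∈ S, t ^ (u i : ℕ) := Finset.prod_nonneg fun i _ => by positivity
    calc _ ≤ Real.exp (t * m / 2) * (∏ i ∈ S, t ^ (u i : ℕ)) * Real.exp (t * m / 2) :=
          (norm_mul_le _ _).trans (mul_le_mul hprod (norm_exp_le hHn) (norm_nonneg _)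
            (mul_nonneg (Real.exp_nonneg _) hp))
      _ = Real.exp (t * m) * ∏ i ∈ S, t ^ (u i : ℕ) := by
          rw [mul_right_comm, ← Real.exp_add, add_halves]
      _ ≤ (∏ i ∈ S, (3 : ℝ) ^ (u i : ℕ)) * ∏ i ∈ S, t ^ (u i : ℕ) := by
          refine mul_le_mul_of_nonneg_right (le_trans ?_ h3) hp
          have := Real.exp_le_exp.2 htm
          linarith [Real.exp_one_lt_d9]
      _ = ∏ i ∈ S, (3 * t) ^ (u i : ℕ) := by
          simp only [mul_pow, Finset.prod_mul_distrib]
      _ ≤ _ := by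
          refine le_mul_of_one_le_left (Finset.prod_nonneg fun i _ => by positivity) ?_
          have : 0 ≤ t / 2 * S.card := by positivity
          nlinarith [sq_nonneg (t * m)]

end Exponential

/-! ### Inclusion-exclusion over the columns with too many ones. -/

section Expansion

theorem prod_finRange_sum {R : Type*} [Ring R] [Algebra ℂ R] {m : ℕ} {κ : Type*}
    (s : Fin m → Finset κ) (f : Fin m → κ → R) :
    ((List.finRange m).map fun i => ∑ c ∈ s i, f i c).prod =
      ∑ r ∈ Fintype.piFinset s, ((List.finRange m).map fun i => f i (r i)).prod := by
  have := (MultilinearMap.mkPiAlgebraFin ℂ m R).map_sum_finset f s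
  simpa only [MultilinearMap.mkPiAlgebraFin_apply, List.ofFn_eq_map] using this

variable {n : Type*} [Fintype n] [DecidableEq n] {M m : ℕ}

/-- The term of the expanded Trotter product that belongs to the table `t`. -/
def tableProd (x : Fin m → Matrix n n ℂ) (t : Fin M → Fin m → Fin 2) : Matrix n n ℂ :=
  ((List.finRange M).map fun j =>
    ((List.finRange m).map fun i => x i ^ (t j i : ℕ)).prod).prod

/-- The sum of the terms whose columns in `S` are given by `u`, the other columns being free. -/
def partialProd (x : Fin m → Matrix n n ℂ) (S : Finset (Fin m)) (u : Fin M → Fin m → Fin 2) :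
    Matrix n n ℂ :=
  ((List.finRange M).map fun j => ((List.finRange m).map (rowFactor x S (u j))).prod).prod

/-- The tables that vanish in the columns outside `S`. -/
def tablesOn (M : ℕ) (S : Finset (Fin m)) : Finset (Fin M → Fin m → Fin 2) :=
  Fintype.piFinset fun _ => Fintype.piFinset fun i => if i ∈ S then Finset.univ else {0}

/-- The tables that have more than `L` ones in column `i`. -/
def heavyColumn (M L : ℕ) (i : Fin m) : Finset (Fin M → Fin m → Fin 2) :=
  Finset.univ.filter fun t => L < ∑ j, (t j i : ℕ)

/-- Distributivity: a free entry contributes `x_i^0 + x_i^1 = 1 + x_i`. -/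
theorem sum_tableProd_eq_partialProd (x : Fin m → Matrix n n ℂ) (S : Finset (Fin m))
    (u : Fin M → Fin m → Fin 2) :
    ∑ t ∈ Fintype.piFinset (fun j => Fintype.piFinset fun i =>
        if i ∈ S then {u j i} else Finset.univ), tableProd x t = partialProd x S u := by
  unfold tableProd partialProd
  rw [← prod_finRange_sum (fun j => Fintype.piFinset fun i =>
        if i ∈ S then {u j i} else Finset.univ)
      (fun _ c => ((List.finRange m).map fun i => x i ^ (c i : ℕ)).prod)]
  congr 2
  funext j
  rw [← prod_finRange_sum (fun i => if i ∈ S then {u j i} else Finset.univ)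
    (fun i c => x i ^ (c : ℕ))]
  congr 2
  funext i
  unfold rowFactor
  split_ifs <;> simp [Fin.sum_univ_two]

/-- Heaviness of the columns in `S` depends only on the restriction of the table to `S`, so tables
are grouped by that restriction, extended by zero. -/
theorem sum_heavy_eq (x : Fin m → Matrix n n ℂ) (S : Finset (Fin m)) (L : ℕ) :
    ∑ t ∈ S.inf (heavyColumn M L), tableProd x t =
      ∑ u ∈ tablesOn M S with ∀ i ∈ S, L < ∑ j, (u j i : ℕ), partialProd x S u := by
  set r : (Fin M → Fin m → Fin 2) → (Fin M → Fin m → Fin 2) := fun t j i =>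
    if i ∈ S then t j i else 0
  have hr : ∀ t : Fin M → Fin m → Fin 2, ∀ i ∈ S, ∀ j, r t j i = t j i := fun t i hi j => by
    simp [r, hi]
  have hmaps : ∀ t ∈ S.inf (heavyColumn M L),
      r t ∈ (tablesOn M S).filter fun u => ∀ i ∈ S, L < ∑ j, (u j i : ℕ) := fun t ht => by
    rw [Finset.mem_inf] at ht
    rw [Finset.mem_filter]
    refine ⟨?_, fun i hi => ?_⟩
    · simp only [tablesOn, Fintype.mem_piFinset, r]
      intro j i
      split_ifs <;> simp
    · have := ht i hi
      simp only [heavyColumn, Finset.mem_filter, Finset.mem_univ, true_and] at this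
      simpa only [hr t i hi] using this
  rw [← Finset.sum_fiberwise_of_maps_to hmaps]
  refine Finset.sum_congr rfl fun u hu => ?_
  rw [← sum_tableProd_eq_partialProd]
  refine Finset.sum_congr ?_ fun _ _ => rfl
  rw [Finset.mem_filter] at hu
  ext t
  simp only [Finset.mem_filter, Finset.mem_inf, Fintype.mem_piFinset]
  constructor
  · rintro ⟨-, rfl⟩ j i
    by_cases hi : i ∈ S <;> simp [r, hi]
  · intro h
    have ht : ∀ i ∈ S, ∀ j, t j i = u j i := fun i hi j => by simpa [hi] using h j i
    refine ⟨fun i hi => ?_, ?_⟩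
    · simp only [heavyColumn, Finset.mem_filter, Finset.mem_univ, true_and, ht i hi]
      exact hu.2 i hi
    · funext j i
      simp only [r]
      split_ifs with hi
      · exact ht i hi j
      · have := hu.1
        simp only [tablesOn, Fintype.mem_piFinset] at this
        simpa [hi, eq_comm] using this j i

/-- The light tables are those in no `heavyColumn`; inclusion-exclusion replaces this global
condition by terms in which only the columns of `S` are constrained. -/
theorem sum_light_eq (x : Fin m → Matrix n n ℂ) (L : ℕ) :
    ∑ t : Fin M → Fin m → Fin 2 with ∀ i, ∑ j, (t j i : ℕ) ≤ L, tableProd x t =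
      ∑ S : Finset (Fin m), (-1 : ℤ) ^ S.card •
        ∑ u ∈ tablesOn M S with ∀ i ∈ S, L < ∑ j, (u j i : ℕ), partialProd x S u := by
  have h := Finset.inclusion_exclusion_sum_inf_compl (Finset.univ : Finset (Fin m))
    (heavyColumn M L) (tableProd x)
  simp only [sum_heavy_eq, Finset.powerset_univ] at h
  rw [← h]
  refine Finset.sum_congr ?_ fun _ _ => rfl
  ext t
  simp [Finset.mem_inf, heavyColumn]

theorem sum_tablesOn_prod (S : Finset (Fin m)) (y : ℝ) :
    ∑ u ∈ tablesOn M S, ∏ j, ∏ i ∈ S, y ^ (u j i : ℕ) = (1 + y) ^ (M * S.card) := by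
  unfold tablesOn
  rw [← Finset.prod_univ_sum (ι := Fin M) (fun _ => Fintype.piFinset fun i =>
    if i ∈ S then (Finset.univ : Finset (Fin 2)) else {0}) (fun _ v => ∏ i ∈ S, y ^ (v i : ℕ))]
  have h : ∑ v ∈ Fintype.piFinset (fun i : Fin m => if i ∈ S then (Finset.univ : Finset (Fin 2))
      else {0}), ∏ i ∈ S, y ^ (v i : ℕ) = (1 + y) ^ S.card := by
    have := Finset.prod_univ_sum (fun i : Fin m => if i ∈ S then (Finset.univ : Finset (Fin 2))
      else {0}) (fun i c => if i ∈ S then y ^ (c : ℕ) else 1)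
    simp only [Finset.prod_ite_mem, Finset.univ_inter] at this
    rw [← this, ← Finset.prod_const, ← Finset.prod_subset (Finset.subset_univ S)
      (fun i _ hi => by simp [hi])]
    exact Finset.prod_congr rfl fun i hi => by simp [hi, Fin.sum_univ_two]
  rw [h, Finset.prod_const, Finset.card_univ, Fintype.card_fin, ← pow_mul, mul_comm]

theorem pow_sub_pow_eq_sum {R : Type*} [Ring R] (a b : R) (M : ℕ) :
    a ^ M - b ^ M = ∑ j ∈ Finset.range M, a ^ j * (a - b) * b ^ (M - 1 - j) := by
  induction M with
  | zero => simp
  | succ M ih =>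
    have h : ∑ j ∈ Finset.range M, a ^ j * (a - b) * b ^ (M + 1 - 1 - j) =
        (∑ j ∈ Finset.range M, a ^ j * (a - b) * b ^ (M - 1 - j)) * b := by
      rw [Finset.sum_mul]
      refine Finset.sum_congr rfl fun j hj => ?_
      rw [mul_assoc _ _ b, ← pow_succ]
      congr 2
      have := Finset.mem_range.1 hj
      omega
    rw [Finset.sum_range_succ, h, ← ih]
    simp [pow_succ]
    noncomm_ring

end Expansion

/-! ### Trace norm error of the truncated Trotter expansion. -/

section TrotterError

open scoped ComplexOrder

variable {n : Type*} [Fintype n] [DecidableEq n] {m : ℕ} {g : Fin m → Matrix n n ℂ}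
  {H : Matrix n n ℂ} {t : ℝ}

theorem posSemidef_exp_smul (hH : H.IsHermitian) (c : ℝ) :
    (NormedSpace.exp ((c : ℂ) • H)).PosSemidef := by
  have h1 : (c : ℂ) • H = ((c / 2 : ℝ) : ℂ) • H + ((c / 2 : ℝ) : ℂ) • H := by
    rw [← add_smul, ← Complex.ofReal_add, add_halves]
  have h2 : (NormedSpace.exp (((c / 2 : ℝ) : ℂ) • H)).IsHermitian := by
    refine Matrix.IsHermitian.exp ?_
    rw [Matrix.IsHermitian, Matrix.conjTranspose_smul, hH.eq]
    simp
  rw [h1, Matrix.exp_add_of_commute _ _ (Commute.refl _)]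
  nth_rewrite 1 [← h2.eq]
  exact Matrix.posSemidef_conjTranspose_mul_self _

theorem exp_smul_mul_exp_neg_smul (t : ℝ) :
    NormedSpace.exp ((t : ℂ) • H) * NormedSpace.exp (((-t : ℝ) : ℂ) • H) = 1 := by
  rw [← Matrix.exp_add_of_commute]
  · simp
  · exact (Commute.refl H).smul_left _ |>.smul_right _

theorem exp_neg_smul_pow (t : ℝ) (M : ℕ) :
    NormedSpace.exp (((-t : ℝ) : ℂ) • H) ^ M =
      NormedSpace.exp (((-(t * M) : ℝ) : ℂ) • H) := by
  rw [← Matrix.exp_nsmul, ← Nat.cast_smul_eq_nsmul ℂ, smul_smul]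
  congr 2
  push_cast; ring

/-- The trace norm of a product of rows `R_j`, with `R_j e^{tH}` under control. -/
theorem traceNorm_prod_rows_le (hH : H.IsHermitian) {k : ℕ}
    (R : Fin (2 ^ (k + 1)) → Matrix n n ℂ) :
    traceNorm ((List.finRange _).map R).prod ≤
      (∏ j, ‖R j * NormedSpace.exp ((t : ℂ) • H)‖) *
        traceNorm (NormedSpace.exp (((-(t * (2 ^ (k + 1) : ℕ)) : ℝ) : ℂ) • H)) := by
  have h := traceNorm_prod_mul_le k (posSemidef_exp_smul hH (-t))
    ((List.finRange (2 ^ (k + 1))).map fun j => R j * NormedSpace.exp ((t : ℂ) • H)) (by simp)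
  rw [List.map_map, List.map_map, ← Fin.prod_univ_def (norm ∘ _), exp_neg_smul_pow] at h
  simpa only [Function.comp_def, mul_assoc, exp_smul_mul_exp_neg_smul, mul_one] using h

theorem traceNorm_partialProd_le (hg : ∀ i, ‖g i‖ ≤ 1) (hgH : ∑ i, g i = (2 : ℂ) • H)
    (hH : H.IsHermitian) (ht : 0 ≤ t) (htm : t * m ≤ 1) {k M : ℕ} (hM : M = 2 ^ (k + 1))
    (S : Finset (Fin m)) (u : Fin M → Fin m → Fin 2) :
    traceNorm (partialProd (fun i => NormedSpace.exp (((-(t / 2) : ℝ) : ℂ) • g i) - 1) S u) ≤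
      (1 + t / 2 * S.card + (t * m) ^ 2) ^ M * (∏ j, ∏ i ∈ S, (3 * t) ^ (u j i : ℕ)) *
        traceNorm (NormedSpace.exp (((-(t * M) : ℝ) : ℂ) • H)) := by
  subst hM
  refine (traceNorm_prod_rows_le (t := t) hH _).trans
    (mul_le_mul_of_nonneg_right ?_ (traceNorm_nonneg _))
  refine (Finset.prod_le_prod (fun j _ => norm_nonneg _) fun j _ =>
    norm_prod_rowFactor_mul_exp_le hg hgH ht htm S (u j)).trans (le_of_eq ?_)
  rw [Finset.prod_mul_distrib, Finset.prod_const, Finset.card_univ, Fintype.card_fin]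

theorem traceNorm_sum_heavy_le (hg : ∀ i, ‖g i‖ ≤ 1) (hgH : ∑ i, g i = (2 : ℂ) • H)
    (hH : H.IsHermitian) (ht : 0 ≤ t) (htm : t * m ≤ 1) {k M : ℕ} (hM : M = 2 ^ (k + 1))
    (L : ℕ) (S : Finset (Fin m)) :
    traceNorm (∑ u ∈ tablesOn M S with ∀ i ∈ S, L < ∑ j, (u j i : ℕ),
        partialProd (fun i => NormedSpace.exp (((-(t / 2) : ℝ) : ℂ) • g i) - 1) S u) ≤
      Real.exp (M * (t * m) ^ 2) * Real.exp (10 * (t * M) - L) ^ S.card *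
        traceNorm (NormedSpace.exp (((-(t * M) : ℝ) : ℂ) • H)) := by
  set T := traceNorm (NormedSpace.exp (((-(t * M) : ℝ) : ℂ) • H))
  have hT : 0 ≤ T := traceNorm_nonneg _
  set B := (1 + t / 2 * S.card + (t * m) ^ 2) ^ M
  have hB : 0 ≤ B := by positivity
  set e := Real.exp 1
  have he : 0 < e := Real.exp_pos 1
  -- Chernoff bound: every column in `S` has more than `L` ones, so `e^{(number of ones) - L} ≥ 1`
  -- may be inserted for it. The constraint on `u` is then dropped and the sum factorises.
  have h1 : ∀ u ∈ (tablesOn M S).filter fun u => ∀ i ∈ S, L < ∑ j, (u j i : ℕ),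
      ∏ j, ∏ i ∈ S, (3 * t) ^ (u j i : ℕ) ≤
        Real.exp (-L) ^ S.card * ∏ j, ∏ i ∈ S, (e * (3 * t)) ^ (u j i : ℕ) := fun u hu => by
    have hp : 0 ≤ ∏ j, ∏ i ∈ S, (3 * t) ^ (u j i : ℕ) :=
      Finset.prod_nonneg fun j _ => Finset.prod_nonneg fun i _ => by positivity
    simp only [mul_pow e, Finset.prod_mul_distrib]
    rw [← mul_assoc]
    refine le_mul_of_one_le_left hp ?_
    rw [Finset.prod_comm, ← Finset.prod_const, ← Finset.prod_mul_distrib]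
    refine Finset.one_le_prod fun i hi => ?_
    rw [Finset.prod_pow_eq_pow_sum, ← Real.exp_nat_mul, ← Real.exp_add]
    refine Real.one_le_exp ?_
    have : (L : ℝ) < ((∑ j, (u j i : ℕ) : ℕ) : ℝ) := by
      exact_mod_cast (Finset.mem_filter.1 hu).2 i hi
    linarith
  have h2 : ∑ u ∈ tablesOn M S with ∀ i ∈ S, L < ∑ j, (u j i : ℕ),
      ∏ j, ∏ i ∈ S, (3 * t) ^ (u j i : ℕ) ≤
        Real.exp (-L) ^ S.card * (1 + e * (3 * t)) ^ (M * S.card) := by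
    refine (Finset.sum_le_sum h1).trans ?_
    rw [← Finset.mul_sum, ← sum_tablesOn_prod]
    refine mul_le_mul_of_nonneg_left ?_ (by positivity)
    exact Finset.sum_le_sum_of_subset_of_nonneg (Finset.filter_subset _ _) fun u _ _ =>
      Finset.prod_nonneg fun j _ => Finset.prod_nonneg fun i _ => by positivity
  -- Per heavy column, the removed exponentials cost `tM/2` in the exponent and the sum over its
  -- entries `9tM`, using `e ≤ 3`; together at most `10tM`.
  have h3 : B * (Real.exp (-L) ^ S.card * (1 + e * (3 * t)) ^ (M * S.card)) ≤
      Real.exp (M * (t * m) ^ 2) * Real.exp (10 * (t * M) - L) ^ S.card := by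
    have hB' : B ≤ Real.exp (M * (t / 2 * S.card + (t * m) ^ 2)) := by
      rw [Real.exp_nat_mul]
      refine pow_le_pow_left₀ (by positivity) ?_ _
      have := Real.add_one_le_exp (t / 2 * S.card + (t * m) ^ 2)
      linarith
    have hC : (1 + e * (3 * t)) ^ (M * S.card) ≤ Real.exp ((M * S.card : ℕ) * (9 * t)) := by
      rw [Real.exp_nat_mul]
      refine pow_le_pow_left₀ (by positivity) ?_ _
      have := Real.add_one_le_exp (9 * t)
      have h9 : e ≤ 3 := by have := Real.exp_one_lt_d9; linarith
      nlinarith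
    calc _ ≤ Real.exp (M * (t / 2 * S.card + (t * m) ^ 2)) *
          (Real.exp (-L) ^ S.card * Real.exp ((M * S.card : ℕ) * (9 * t))) :=
          mul_le_mul hB' (mul_le_mul_of_nonneg_left hC (by positivity)) (by positivity)
            (by positivity)
      _ ≤ _ := by
          rw [← Real.exp_nat_mul, ← Real.exp_nat_mul, ← Real.exp_add, ← Real.exp_add,
            ← Real.exp_add, Real.exp_le_exp]
          have : 0 ≤ t * M * S.card := by positivity
          push_cast
          nlinarith
  calc _ ≤ ∑ u ∈ tablesOn M S with ∀ i ∈ S, L < ∑ j, (u j i : ℕ),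
        B * (∏ j, ∏ i ∈ S, (3 * t) ^ (u j i : ℕ)) * T :=
        (traceNorm_sum_le _ _).trans (Finset.sum_le_sum fun u _ =>
          traceNorm_partialProd_le hg hgH hH ht htm hM S u)
    _ = B * (∑ u ∈ tablesOn M S with ∀ i ∈ S, L < ∑ j, (u j i : ℕ),
        ∏ j, ∏ i ∈ S, (3 * t) ^ (u j i : ℕ)) * T := by
        rw [Finset.mul_sum, Finset.sum_mul]
    _ ≤ B * (Real.exp (-L) ^ S.card * (1 + e * (3 * t)) ^ (M * S.card)) * T :=
        mul_le_mul_of_nonneg_right (mul_le_mul_of_nonneg_left h2 hB) hT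
    _ ≤ _ := mul_le_mul_of_nonneg_right h3 hT

/-- Telescoping `A^M - R^M` with `R = YA` gives words of exactly `M` factors of the form `(·)A`, so
Hölder bounds each by `‖1 - Y‖ ≤ (tm)^2` relative to `tr A^M`. -/
theorem traceNorm_exp_sub_trotter_le (hg : ∀ i, ‖g i‖ ≤ 1) (hgH : ∑ i, g i = (2 : ℂ) • H)
    (hH : H.IsHermitian) (ht : 0 ≤ t) (htm : t * m ≤ 1) {k M : ℕ} (hM : M = 2 ^ (k + 1)) :
    traceNorm (NormedSpace.exp (((-(t * M) : ℝ) : ℂ) • H) -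
      ((List.finRange m).map fun i => NormedSpace.exp (((-(t / 2) : ℝ) : ℂ) • g i)).prod ^ M) ≤
      M * (t * m) ^ 2 * Real.exp (M * (t * m) ^ 2) *
        traceNorm (NormedSpace.exp (((-(t * M) : ℝ) : ℂ) • H)) := by
  set R := ((List.finRange m).map fun i => NormedSpace.exp (((-(t / 2) : ℝ) : ℂ) • g i)).prod
  set A := NormedSpace.exp (((-t : ℝ) : ℂ) • H)
  set Y := R * NormedSpace.exp ((t : ℂ) • H)
  have hYA : Y * A = R := by simp only [Y, A, mul_assoc, exp_smul_mul_exp_neg_smul, mul_one]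
  have hY : ‖Y - 1‖ ≤ (t * m) ^ 2 := by
    simpa [Y, R] using norm_prod_removed_sub_one_sub_le hg hgH ht htm ∅
  have hY1 : ‖Y‖ ≤ Real.exp ((t * m) ^ 2) := by
    have h1 : ‖Y‖ ≤ 1 + ‖Y - 1‖ := by
      calc ‖Y‖ = ‖1 + (Y - 1)‖ := by congr 1; abel
        _ ≤ _ := (norm_add_le _ _).trans (add_le_add norm_one_le_one le_rfl)
    have := Real.add_one_le_exp ((t * m) ^ 2)
    linarith
  rw [← exp_neg_smul_pow]
  have hterm : ∀ j ∈ Finset.range M, traceNorm (A ^ j * (A - R) * R ^ (M - 1 - j)) ≤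
      (t * m) ^ 2 * Real.exp (M * (t * m) ^ 2) * traceNorm (A ^ M) := fun j hj => by
    have hj := Finset.mem_range.1 hj
    have h := traceNorm_prod_mul_le k (posSemidef_exp_smul hH (-t))
      (List.replicate j 1 ++ [1 - Y] ++ List.replicate (M - 1 - j) Y) (by simp; omega)
    simp only [List.map_append, List.map_replicate, List.prod_append, List.prod_replicate,
      List.map_singleton, List.prod_singleton, one_mul, sub_mul, ← hM] at h
    change traceNorm (A ^ j * (A - Y * A) * (Y * A) ^ (M - 1 - j)) ≤ _ at h
    rw [hYA] at h
    refine h.trans (mul_le_mul_of_nonneg_right ?_ (traceNorm_nonneg _))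
    have h1 : ‖(1 : Matrix n n ℂ)‖ ^ j ≤ 1 := pow_le_one₀ (norm_nonneg _) norm_one_le_one
    have h2 : ‖Y‖ ^ (M - 1 - j) ≤ Real.exp (M * (t * m) ^ 2) := by
      refine (pow_le_pow_left₀ (norm_nonneg _) hY1 _).trans ?_
      rw [Real.exp_nat_mul]
      exact pow_le_pow_right₀ (Real.one_le_exp (sq_nonneg _)) (by omega)
    rw [norm_sub_rev]
    calc _ ≤ 1 * (t * m) ^ 2 * Real.exp (M * (t * m) ^ 2) :=
          mul_le_mul (mul_le_mul h1 hY (norm_nonneg _) zero_le_one) h2 (by positivity)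
            (by positivity)
      _ = _ := by rw [one_mul]
  rw [pow_sub_pow_eq_sum]
  refine (traceNorm_sum_le _ _).trans ((Finset.sum_le_sum hterm).trans (le_of_eq ?_))
  rw [Finset.sum_const, Finset.card_range, nsmul_eq_mul]
  ring

theorem traceNorm_exp_sub_sum_light_le (hg : ∀ i, ‖g i‖ ≤ 1) (hgH : ∑ i, g i = (2 : ℂ) • H)
    (hH : H.IsHermitian) (ht : 0 ≤ t) (htm : t * m ≤ 1) {k M : ℕ} (hM : M = 2 ^ (k + 1))
    {L : ℕ} {ε : ℝ} (hε1 : ε ≤ 1) (hη : M * (t * m) ^ 2 ≤ ε / 8)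
    (hq : m * Real.exp (10 * (t * M) - L) ≤ ε / 8) :
    traceNorm (NormedSpace.exp (((-(t * M) : ℝ) : ℂ) • H) -
      ∑ u : Fin M → Fin m → Fin 2 with ∀ i, ∑ j, (u j i : ℕ) ≤ L,
        tableProd (fun i => NormedSpace.exp (((-(t / 2) : ℝ) : ℂ) • g i) - 1) u) ≤
      ε * traceNorm (NormedSpace.exp (((-(t * M) : ℝ) : ℂ) • H)) := by
  set x : Fin m → Matrix n n ℂ := fun i => NormedSpace.exp (((-(t / 2) : ℝ) : ℂ) • g i) - 1
  set T := traceNorm (NormedSpace.exp (((-(t * M) : ℝ) : ℂ) • H))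
  have hT : 0 ≤ T := traceNorm_nonneg _
  set F : Finset (Fin m) → Matrix n n ℂ := fun S => (-1 : ℤ) ^ S.card •
    ∑ u ∈ tablesOn M S with ∀ i ∈ S, L < ∑ j, (u j i : ℕ), partialProd x S u
  set q := Real.exp (10 * (t * M) - L)
  set η := M * (t * m) ^ 2
  have hη0 : 0 ≤ η := by positivity
  -- The empty set of heavy columns gives the untruncated Trotter product; all other sets are error
  -- terms.
  have hempty : F ∅ =
      ((List.finRange m).map fun i => NormedSpace.exp (((-(t / 2) : ℝ) : ℂ) • g i)).prod ^ M := by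
    have h1 : tablesOn M (∅ : Finset (Fin m)) = {fun _ _ => 0} := by
      ext u; simp [tablesOn, funext_iff]
    have h2 : ∀ u, rowFactor x ∅ u = fun i => NormedSpace.exp (((-(t / 2) : ℝ) : ℂ) • g i) :=
      fun u => by funext i; simp [rowFactor, x]
    simp only [F, h1, partialProd, h2]
    simp
  have hF : ∀ S, traceNorm (F S) ≤ Real.exp η * q ^ S.card * T := fun S => by
    refine le_trans ?_ (traceNorm_sum_heavy_le hg hgH hH ht htm hM L S)
    simp only [F]
    rcases neg_one_pow_eq_or ℤ S.card with h | h
    · rw [h, one_smul]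
    · rw [h, ← Int.cast_smul_eq_zsmul ℂ]
      refine (traceNorm_smul_le _ _).trans (le_of_eq ?_)
      simp [x]
  have hsum : ∑ S ∈ Finset.univ.erase (∅ : Finset (Fin m)), q ^ S.card = (1 + q) ^ m - 1 := by
    have h1 := Fintype.sum_pow_mul_eq_add_pow (Fin m) q 1
    simp only [one_pow, mul_one, Fintype.card_fin] at h1
    rw [← Finset.add_sum_erase _ _ (Finset.mem_univ (∅ : Finset (Fin m)))] at h1
    rw [add_comm 1 q, ← h1]
    simp
  rw [sum_light_eq]
  change traceNorm (_ - ∑ S, F S) ≤ _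
  rw [← Finset.add_sum_erase _ _ (Finset.mem_univ (∅ : Finset (Fin m))), ← sub_sub]
  have h1 := traceNorm_exp_sub_trotter_le hg hgH hH ht htm hM
  rw [← hempty] at h1
  have h2 : traceNorm (∑ S ∈ Finset.univ.erase ∅, F S) ≤ Real.exp η * ((1 + q) ^ m - 1) * T := by
    refine (traceNorm_sum_le _ _).trans ((Finset.sum_le_sum fun S _ => hF S).trans (le_of_eq ?_))
    rw [← Finset.sum_mul, ← Finset.mul_sum, hsum]
  have h3 : (1 + q) ^ m - 1 ≤ ε / 4 := by
    have hle : (1 + q) ^ m ≤ Real.exp (m * q) := by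
      rw [Real.exp_nat_mul]
      refine pow_le_pow_left₀ (by positivity) ?_ _
      linarith [Real.add_one_le_exp q]
    have h0 : 0 ≤ m * q := by positivity
    have := exp_sub_one_sub_le_sq h0 le_rfl (by linarith)
    nlinarith
  have h4 : Real.exp η ≤ 2 := by
    have := exp_sub_one_sub_le_sq hη0 le_rfl (by linarith)
    nlinarith
  have h30 : 0 ≤ (1 + q) ^ m - 1 := by
    have := one_le_pow₀ (n := m) (show 1 ≤ 1 + q by linarith [Real.exp_pos (10 * (t * M) - L)])
    linarith
  refine (traceNorm_sub_le _ _).trans ((add_le_add h1 h2).trans ?_)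
  rw [← add_mul]
  refine mul_le_mul_of_nonneg_right ?_ hT
  have hexp := Real.exp_pos η
  change η * Real.exp η + Real.exp η * _ ≤ ε
  -- The Trotter error is at most `2 · ε/8` and the truncation error at most `2 · ε/4`.
  nlinarith [mul_nonneg hη0 hexp.le]

end TrotterError

/-! ### Decomposing the two-site terms into products of one-site operators. -/

section SchmidtRank

open scoped Kronecker

/-- `a ↦ a ⊗ 1`, as a ring homomorphism. -/
def extendOp {V : Type u} [Fintype V] [DecidableEq V] (d : ℕ) (S : Set V)
    [DecidablePred (· ∈ S)] :
    Matrix (S → Fin d) (S → Fin d) ℂ →+* Op V d where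
  toFun a := (a ⊗ₖ (1 : Matrix ({v // v ∉ S} → Fin d) ({v // v ∉ S} → Fin d) ℂ)).submatrix
    (Equiv.piEquivPiSubtypeProd (· ∈ S) fun _ => Fin d)
    (Equiv.piEquivPiSubtypeProd (· ∈ S) fun _ => Fin d)
  map_one' := by
    rw [Matrix.one_kronecker_one]
    exact Matrix.submatrix_one_equiv _
  map_mul' a b := by
    rw [Matrix.submatrix_mul_equiv, ← Matrix.mul_kronecker_mul, one_mul]
  map_zero' := by rw [Matrix.zero_kronecker]; rfl
  map_add' a b := by rw [Matrix.add_kronecker]; rfl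

variable {V : Type u} [Fintype V] [DecidableEq V] {d : ℕ}

theorem extendOp_apply (S : Set V) [DecidablePred (· ∈ S)]
    (a : Matrix (S → Fin d) (S → Fin d) ℂ) (σ τ : V → Fin d) :
    extendOp d S a σ τ = a (fun v => σ v) (fun v => τ v) *
      (1 : Matrix ({v // v ∉ S} → Fin d) ({v // v ∉ S} → Fin d) ℂ)
        (fun v => σ v) (fun v => τ v) := rfl

theorem continuous_extendOp (S : Set V) [DecidablePred (· ∈ S)] : Continuous (extendOp d S) := by
  refine continuous_matrix fun σ τ => ?_
  simp only [extendOp_apply]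
  exact (continuous_id.matrix_elem _ _).mul continuous_const

theorem actsOn_iff {S : Set V} [DecidablePred (· ∈ S)] {A : Op V d} :
    ActsOn S A ↔ ∃ a, A = extendOp d S a := by
  have h : ∀ σ τ : V → Fin d, (1 : Matrix ({v // v ∉ S} → Fin d) ({v // v ∉ S} → Fin d) ℂ)
      (fun v => σ v) (fun v => τ v) = if ∀ v ∉ S, σ v = τ v then 1 else 0 := fun σ τ => by
    rw [Matrix.one_apply]
    refine if_congr ?_ rfl rfl
    simp [funext_iff]
  constructor
  · rintro ⟨a, ha⟩
    refine ⟨a, ?_⟩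
    ext σ τ
    rw [extendOp_apply, h]
    split_ifs with hst
    · rw [mul_one]; exact (ha σ τ).1 hst
    · rw [mul_zero]; push Not at hst; exact (ha σ τ).2 hst
  · rintro ⟨a, rfl⟩
    refine ⟨a, fun σ τ => ⟨fun hst => ?_, fun hst => ?_⟩⟩
    · rw [extendOp_apply, h, if_pos hst, mul_one]
    · rw [extendOp_apply, h, if_neg (by push Not; exact hst), mul_zero]

/-- The map `a ↦ a ⊗ 1` is a continuous ring homomorphism, hence commutes with the exponential. -/
theorem ActsOn.exp_smul_sub_one {S : Set V} {A : Op V d} (hA : ActsOn S A) (c : ℂ) :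
    ActsOn S (NormedSpace.exp (c • A) - 1) := by
  classical
  obtain ⟨a, rfl⟩ := actsOn_iff.1 hA
  refine actsOn_iff.2 ⟨NormedSpace.exp (c • a) - 1, ?_⟩
  let : NormedAlgebra ℚ (Matrix (S → Fin d) (S → Fin d) ℂ) := .restrictScalars ℚ ℂ _
  rw [map_sub, map_one, NormedSpace.map_exp _ (continuous_extendOp S)]
  congr 2
  ext σ τ
  simp [extendOp_apply, mul_assoc]

/-- Expansion in the `d²` matrix units at `v`; the coefficient of each is an operator at `w`. -/
theorem ActsOn.schmidtRankLE {v w : V} (hvw : v ≠ w) {A : Op V d}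
    (hA : ActsOn {u | u ∈ s(v, w)} A) : SchmidtRankLE s(v, w) (d ^ 2) A := by
  obtain ⟨a, ha⟩ := hA
  set φ : Fin (d ^ 2) ≃ Fin d × Fin d := (Fintype.equivFinOfCardEq (by simp [sq])).symm
  -- The configuration of the edge with value `p` at `v` and `r` at `w`.
  set P : Fin d → Fin d → ({u | u ∈ s(v, w)} : Set V) → Fin d := fun p r u =>
    if (u : V) = v then p else r
  refine ⟨v, w, rfl, fun ν => Matrix.single (φ ν).1 (φ ν).2 1,
    fun ν => Matrix.of fun r t => a (P (φ ν).1 r) (P (φ ν).2 t), ?_⟩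
  ext σ τ
  rw [Matrix.sum_apply, ← φ.symm.sum_comp]
  simp only [siteTensor, Matrix.of_apply, Equiv.apply_symm_apply]
  have hprod : ∀ pq : Fin d × Fin d, (∏ u, (if u = v then Matrix.single pq.1 pq.2 (1 : ℂ) else
      if u = w then Matrix.of fun r t => a (P pq.1 r) (P pq.2 t) else 1) (σ u) (τ u)) =
      (if pq = (σ v, τ v) then 1 else 0) * (a (P pq.1 (σ w)) (P pq.2 (τ w)) *
        ∏ u ∈ (Finset.univ.erase v).erase w, (1 : Matrix (Fin d) (Fin d) ℂ) (σ u) (τ u)) :=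
      fun pq => by
    rw [← Finset.mul_prod_erase _ _ (Finset.mem_univ v),
      ← Finset.mul_prod_erase (Finset.univ.erase v) _ (a := w) (by simp [hvw.symm])]
    congr 1
    · rw [if_pos rfl, Matrix.single_apply]
      refine if_congr ?_ rfl rfl
      rw [Prod.ext_iff]
    · congr 1
      · rw [if_neg hvw.symm, if_pos rfl]; rfl
      · refine Finset.prod_congr rfl fun u hu => ?_
        simp only [Finset.mem_erase] at hu
        rw [if_neg hu.2.1, if_neg hu.1]
  simp only [hprod, ite_mul, one_mul, zero_mul, Finset.sum_ite_eq', Finset.mem_univ, if_true]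
  have hP : ∀ σ : V → Fin d, P (σ v) (σ w) = fun u => σ u.1 := fun σ => by
    funext u
    rcases Sym2.mem_iff.1 u.2 with h | h
    · simp [P, h]
    · simp [P, h, hvw.symm]
  rw [hP, hP]
  by_cases hst : ∀ u ∉ ({u | u ∈ s(v, w)} : Set V), σ u = τ u
  · rw [(ha σ τ).1 hst, Finset.prod_eq_one, mul_one]
    intro u hu
    simp only [Finset.mem_erase] at hu
    rw [hst u (by simp [hu.1, hu.2.1]), Matrix.one_apply_eq]
  · push Not at hst
    rw [(ha σ τ).2 hst]
    obtain ⟨u, hu, hne⟩ := hst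
    simp only [Set.mem_ofPred_eq, Sym2.mem_iff, not_or] at hu
    have h0 : ∏ u ∈ (Finset.univ.erase v).erase w, (1 : Matrix (Fin d) (Fin d) ℂ) (σ u) (τ u) = 0 :=
      Finset.prod_eq_zero (i := u) (by simp [hu.1, hu.2]) (Matrix.one_apply_ne hne)
    rw [h0, mul_zero]

theorem schmidtRankLE_trotterTerm {G : SimpleGraph V} [DecidableRel G.Adj] {K : ℕ}
    (ord : Fin K ≃ G.edgeSet) {h : G.edgeSet → Op V d} (hh : IsInteraction G h) (β : ℝ) (M : ℕ)
    (i : Fin (K + K)) :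
    SchmidtRankLE (ord (column K i) : Sym2 V) (d ^ 2) (trotterTerm ord h β M i) := by
  have hA := ((hh (ord (column K i))).2.1).exp_smul_sub_one ((-(β / (2 * M)) : ℝ) : ℂ)
  have he := (ord (column K i)).2
  unfold trotterTerm
  revert hA
  generalize NormedSpace.exp ((((-(β / (2 * M)) : ℝ) : ℂ)) • h (ord (column K i))) - 1 = A
  revert he
  generalize ((ord (column K i) : G.edgeSet) : Sym2 V) = e
  induction e with | _ v w =>
  intro he hA
  exact hA.schmidtRankLE (G.ne_of_adj he)

end SchmidtRank

/-! ### From the truncated expansion to a tensor network. -/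

section PEPO

variable {V : Type u} [Fintype V] {d : ℕ}

theorem siteTensor_one : siteTensor (fun _ : V => (1 : Matrix (Fin d) (Fin d) ℂ)) = 1 := by
  ext σ τ
  simp only [siteTensor, Matrix.of_apply, Matrix.one_apply]
  rw [Finset.prod_ite_zero]
  simp [funext_iff]

variable [DecidableEq V]

theorem siteTensor_mul (A B : V → Matrix (Fin d) (Fin d) ℂ) :
    siteTensor A * siteTensor B = siteTensor fun v => A v * B v := by
  ext σ τ
  simp only [siteTensor, Matrix.mul_apply, Matrix.of_apply]
  rw [Finset.prod_univ_sum, Fintype.piFinset_univ]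
  exact Finset.sum_congr rfl fun _ _ => Finset.prod_mul_distrib.symm

theorem prod_map_siteTensor {ι : Type*} (l : List ι) (f : ι → V → Matrix (Fin d) (Fin d) ℂ) :
    (l.map fun j => siteTensor (f j)).prod = siteTensor fun v => (l.map fun j => f j v).prod := by
  induction l with
  | nil => exact siteTensor_one.symm
  | cons a l ih => simp only [List.map_cons, List.prod_cons, ih, siteTensor_mul]

/-- The labels of a column: a choice of at most `L` rows, and of one of `s` values in each. -/
abbrev ColumnLabel (M L s : ℕ) : Type :=
  {f : Fin M → Option (Fin s) // (Finset.univ.filter fun j => f j ≠ none).card ≤ L}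

/-- The factor that belongs to the entry `o` of a column with the one-site operators `c`. -/
def labelFactor {s : ℕ} (c : Fin s → V → Matrix (Fin d) (Fin d) ℂ) (o : Option (Fin s)) (v : V) :
    Matrix (Fin d) (Fin d) ℂ :=
  o.elim 1 fun ν => c ν v

theorem tableProd_eq_sum {M m s : ℕ} (c : Fin m → Fin s → V → Matrix (Fin d) (Fin d) ℂ)
    (t : Fin M → Fin m → Fin 2) :
    tableProd (fun i => ∑ ν, siteTensor (c i ν)) t =
      ∑ r : Fin M → Fin m → Option (Fin s) with (fun j i => if r j i = none then 0 else 1) = t,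
        siteTensor fun v => ((List.finRange M).map fun j =>
          ((List.finRange m).map fun i => labelFactor (c i) (r j i) v).prod).prod := by
  set O : Fin 2 → Finset (Option (Fin s)) := fun b =>
    Finset.univ.filter fun o => (if o = none then 0 else 1) = b
  have hO : ∀ i (b : Fin 2), (∑ ν, siteTensor (c i ν)) ^ (b : ℕ) =
      ∑ o ∈ O b, siteTensor (labelFactor (c i) o) := fun i b => by
    have h01 : b = 0 ∨ b = 1 := by omega
    rcases h01 with rfl | rfl
    · have : O 0 = {none} := by ext o; cases o <;> simp [O]
      rw [this, Finset.sum_singleton]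
      exact siteTensor_one.symm
    · have : O 1 = Finset.univ.map Function.Embedding.some := by
        ext o; cases o <;> simp [O]
      rw [this, Finset.sum_map, Fin.val_one, pow_one]
      rfl
  unfold tableProd
  simp only [hO, prod_finRange_sum]
  refine Finset.sum_congr ?_ fun r _ => ?_
  · ext r
    simp [O, Fintype.mem_piFinset, funext_iff]
  · simp only [prod_map_siteTensor]

/-- The bound on the number of ones concerns each column separately, so the admissible refined
tables are exactly the free families of column labels. -/
theorem sum_light_tableProd_eq {M m s L : ℕ} (c : Fin m → Fin s → V → Matrix (Fin d) (Fin d) ℂ) :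
    ∑ t : Fin M → Fin m → Fin 2 with ∀ i, ∑ j, (t j i : ℕ) ≤ L,
        tableProd (fun i => ∑ ν, siteTensor (c i ν)) t =
      ∑ α : Fin m → ColumnLabel M L s, siteTensor fun v => ((List.finRange M).map fun j =>
          ((List.finRange m).map fun i => labelFactor (c i) ((α i).1 j) v).prod).prod := by
  set τ : (Fin M → Fin m → Option (Fin s)) → (Fin M → Fin m → Fin 2) := fun r j i =>
    if r j i = none then 0 else 1
  have hτ : ∀ r i, ∑ j, (τ r j i : ℕ) = (Finset.univ.filter fun j => r j i ≠ none).card :=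
    fun r i => by
      rw [Finset.card_filter]
      exact Finset.sum_congr rfl fun j _ => by by_cases h : r j i = none <;> simp [τ, h]
  set F : (Fin M → Fin m → Option (Fin s)) → Op V d := fun r =>
    siteTensor fun v => ((List.finRange M).map fun j =>
      ((List.finRange m).map fun i => labelFactor (c i) (r j i) v).prod).prod
  have h1 : ∑ t : Fin M → Fin m → Fin 2 with ∀ i, ∑ j, (t j i : ℕ) ≤ L,
        tableProd (fun i => ∑ ν, siteTensor (c i ν)) t =
      ∑ r : Fin M → Fin m → Option (Fin s) with
        ∀ i, (Finset.univ.filter fun j => r j i ≠ none).card ≤ L, F r := by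
    have hmaps : ∀ r ∈ (Finset.univ.filter fun r : Fin M → Fin m → Option (Fin s) =>
        ∀ i, (Finset.univ.filter fun j => r j i ≠ none).card ≤ L),
        τ r ∈ Finset.univ.filter fun t : Fin M → Fin m → Fin 2 => ∀ i, ∑ j, (t j i : ℕ) ≤ L :=
      fun r hr => by
        simp only [Finset.mem_filter, Finset.mem_univ, true_and] at hr ⊢
        simpa only [hτ] using hr
    rw [← Finset.sum_fiberwise_of_maps_to hmaps]
    refine Finset.sum_congr rfl fun t ht => ?_
    rw [tableProd_eq_sum]
    refine Finset.sum_congr ?_ fun _ _ => rfl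
    ext r
    simp only [Finset.mem_filter, Finset.mem_univ, true_and] at ht ⊢
    constructor
    · rintro rfl
      exact ⟨fun i => (hτ r i) ▸ ht i, rfl⟩
    · exact fun h => h.2
  rw [h1]
  refine Finset.sum_bij' (fun r hr i => ⟨fun j => r j i, (Finset.mem_filter.1 hr).2 i⟩)
    (fun α _ j i => (α i).1 j) ?_ ?_ ?_ ?_ ?_
  · intro r _; exact Finset.mem_univ _
  · intro α _
    exact Finset.mem_filter.2 ⟨Finset.mem_univ _, fun i => (α i).2⟩
  · intro r _; rfl
  · intro α _; rfl
  · intro r _; rfl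

/-- Which of the two labels of an edge belongs to a column. -/
def pickLabel {B : Type*} (K : ℕ) (i : Fin (K + K)) : B × B → B :=
  Fin.addCases (fun _ => Prod.fst) (fun _ => Prod.snd) i

/-- Labels of the edges by pairs are the same as labels of the columns. -/
def edgeLabelEquiv {E B : Type*} {K : ℕ} (ord : Fin K ≃ E) :
    (E → B × B) ≃ (Fin (K + K) → B) where
  toFun b i := pickLabel K i (b (ord (column K i)))
  -- The first `K` columns run through the edges backwards, hence the `rev`.
  invFun α e := (α (Fin.castAdd K (ord.symm e).rev), α (Fin.natAdd K (ord.symm e)))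
  left_inv b := by
    funext e
    simp only [pickLabel, column, Fin.addCases_left, Fin.addCases_right, Fin.rev_rev, id,
      Equiv.apply_symm_apply]
  right_inv α := by
    funext i
    refine Fin.addCases (fun k => ?_) (fun k => ?_) i <;>
      simp only [pickLabel, column, Fin.addCases_left, Fin.addCases_right, Fin.rev_rev, id,
        Equiv.symm_apply_apply]

/-- For a fixed labelling every term is a product over sites, and at site `v` the columns of edges
not containing `v` contribute `1`. The tensor at `v` thus needs only the labels of its incident
edges, one for each of the two columns of an edge. -/
theorem isPEPO_sum_light {G : SimpleGraph V} [DecidableRel G.Adj] {K M s : ℕ} (L : ℕ)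
    (ord : Fin K ≃ G.edgeSet) (c : Fin (K + K) → Fin s → V → Matrix (Fin d) (Fin d) ℂ)
    (hc : ∀ i ν v, v ∉ (ord (column K i) : Sym2 V) → c i ν v = 1) :
    IsPEPO G (Fintype.card (ColumnLabel M L s × ColumnLabel M L s))
      (∑ t : Fin M → Fin (K + K) → Fin 2 with ∀ i, ∑ j, (t j i : ℕ) ≤ L,
        tableProd (fun i => ∑ ν, siteTensor (c i ν)) t) := by
  classical
  set B := ColumnLabel M L s
  set φ : Fin (Fintype.card (B × B)) ≃ B × B := (Fintype.equivFin _).symm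
  refine ⟨fun v γ => ((List.finRange M).map fun j => ((List.finRange (K + K)).map fun i =>
    if hi : v ∈ (ord (column K i) : Sym2 V) then
      labelFactor (c i) ((pickLabel K i (φ (γ ⟨ord (column K i), hi⟩))).1 j) v else 1).prod).prod,
    ?_⟩
  rw [sum_light_tableProd_eq, ← (edgeLabelEquiv ord).sum_comp,
    ← (Equiv.arrowCongr (Equiv.refl G.edgeSet) φ).sum_comp]
  refine Finset.sum_congr rfl fun α _ => ?_
  congr 1
  funext v
  congr 2
  funext j
  congr 2
  funext i
  split_ifs with hi
  · rfl
  · unfold labelFactor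
    cases ((edgeLabelEquiv ord) ((Equiv.arrowCongr (Equiv.refl G.edgeSet) φ) α) i).1 j with
    | none => rfl
    | some ν => exact hc i ν v hi

/-- A label is encoded by its graph, a subset of `Fin M × Fin s` with at most `L` elements. The
geometric sum of `(sM)^l` is at most `2 (sM)^L` as `sM ≥ 2`, and `L ≥ 2` absorbs the factor `2`. -/
theorem card_columnLabel_le {M L s : ℕ} (hL : 2 ≤ L) (hm : 2 ≤ s * M) :
    Fintype.card (ColumnLabel M L s) ≤ L * (s * M) ^ L := by
  have hinj : Fintype.card (ColumnLabel M L s) ≤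
      (Finset.univ.filter fun A : Finset (Fin M × Fin s) => A.card ≤ L).card := by
    refine Finset.card_le_card_of_injOn (s := Finset.univ)
      (fun f => Finset.univ.filter fun p => f.1 p.1 = some p.2) ?_ ?_
    · intro f _
      simp only [Finset.coe_filter, Finset.mem_univ, true_and, Set.mem_ofPred_eq]
      refine le_trans ?_ f.2
      refine Finset.card_le_card_of_injOn Prod.fst ?_ ?_
      · intro p hp
        simp only [Finset.coe_filter, Finset.mem_univ, true_and, Set.mem_ofPred_eq] at hp ⊢
        simp [hp]
      · intro p hp q hq hpq
        simp only [Finset.coe_filter, Finset.mem_univ, true_and, Set.mem_ofPred_eq] at hp hq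
        rw [hpq, hq] at hp
        exact Prod.ext hpq (Option.some_injective _ hp).symm
    · intro f _ f' _ hff
      refine Subtype.ext (funext fun j => Option.ext fun ν => ?_)
      have := Finset.ext_iff.1 hff (j, ν)
      simpa using this
  have hsub : (Finset.univ.filter fun A : Finset (Fin M × Fin s) => A.card ≤ L) ⊆
      (Finset.range (L + 1)).biUnion fun l => Finset.univ.powersetCard l := by
    intro A hA
    simp only [Finset.mem_filter, Finset.mem_univ, true_and] at hA
    simp only [Finset.mem_biUnion, Finset.mem_range, Finset.mem_powersetCard_univ]
    exact ⟨A.card, by omega, rfl⟩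
  have hgeom : ∀ l, ∑ i ∈ Finset.range (l + 1), (s * M) ^ i ≤ 2 * (s * M) ^ l := fun l => by
    induction l with
    | zero => simp
    | succ l ih =>
      rw [Finset.sum_range_succ]
      have : 2 * (s * M) ^ l ≤ (s * M) ^ (l + 1) := by
        rw [pow_succ']; exact Nat.mul_le_mul_right _ hm
      omega
  calc _ ≤ _ := hinj
    _ ≤ _ := Finset.card_le_card hsub
    _ ≤ ∑ l ∈ Finset.range (L + 1), (s * M) ^ l := by
        refine Finset.card_biUnion_le.trans (Finset.sum_le_sum fun l _ => ?_)
        rw [Finset.card_powersetCard, Finset.card_univ, Fintype.card_prod, Fintype.card_fin,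
          Fintype.card_fin, mul_comm s M]
        exact Nat.choose_le_pow _ _
    _ ≤ 2 * (s * M) ^ L := hgeom L
    _ ≤ L * (s * M) ^ L := Nat.mul_le_mul_right _ hL

theorem exists_isPEPO_truncatedTrotter {G : SimpleGraph V} [DecidableRel G.Adj] {K M L s : ℕ}
    (ord : Fin K ≃ G.edgeSet) (h : G.edgeSet → Op V d) (β : ℝ) (hL : 2 ≤ L) (hm : 2 ≤ s * M)
    (hs : ∀ i, SchmidtRankLE (ord (column K i) : Sym2 V) s (trotterTerm ord h β M i)) :
    ∃ D : ℕ, IsPEPO G D (truncatedTrotter ord h β M L) ∧ D ≤ L ^ 2 * (s * M) ^ (2 * L) := by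
  choose v w hvw a b hab using hs
  refine ⟨Fintype.card (ColumnLabel M L s × ColumnLabel M L s), ?_, ?_⟩
  · have := isPEPO_sum_light (M := M) L ord (fun i ν u => if u = v i then a i ν else
      if u = w i then b i ν else 1) (fun i ν u hu => by
        rw [hvw, Sym2.mem_iff, not_or] at hu
        rw [if_neg hu.1, if_neg hu.2])
    simp only [← hab] at this
    exact this
  · rw [Fintype.card_prod, ← sq]
    refine (Nat.pow_le_pow_left (card_columnLabel_le hL hm) 2).trans (le_of_eq ?_)
    ring

/-- The scalar is absorbed into the tensor of a single site. -/
theorem IsPEPO.smul {G : SimpleGraph V} [DecidableRel G.Adj] [Nonempty V] {D : ℕ} {ρ : Op V d}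
    (hρ : IsPEPO G D ρ) (z : ℂ) : IsPEPO G D (z • ρ) := by
  obtain ⟨X, hX⟩ := hρ
  obtain ⟨v₀⟩ := ‹Nonempty V›
  refine ⟨fun v γ => if v = v₀ then z • X v γ else X v γ, ?_⟩
  rw [hX, Finset.smul_sum]
  refine Finset.sum_congr rfl fun α _ => ?_
  ext σ τ
  simp only [siteTensor, Matrix.smul_apply, Matrix.of_apply, smul_eq_mul]
  rw [← Finset.mul_prod_erase _ _ (Finset.mem_univ v₀),
    ← Finset.mul_prod_erase Finset.univ (fun v => (if v = v₀ then _ else _ :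
      Matrix (Fin d) (Fin d) ℂ) (σ v) (τ v)) (Finset.mem_univ v₀), if_pos rfl, Matrix.smul_apply,
    smul_eq_mul, mul_assoc]
  congr 2
  refine Finset.prod_congr rfl fun v hv => ?_
  rw [if_neg (Finset.ne_of_mem_erase hv)]

theorem IsPEPO.isPEPS_col {G : SimpleGraph V} [DecidableRel G.Adj] {D : ℕ} {ρ : Op V d}
    (hρ : IsPEPO G D ρ) (τ : V → Fin d) : IsPEPS G D fun σ => ρ σ τ := by
  obtain ⟨X, hX⟩ := hρ
  refine ⟨fun v γ p => X v γ p (τ v), ?_⟩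
  funext σ
  rw [hX, Matrix.sum_apply]
  rfl

end PEPO

/-! ### Choice of parameters and Gibbs states. -/

section Gibbs

variable {V : Type u} [Fintype V] {G : SimpleGraph V} [DecidableRel G.Adj]

theorem card_le_of_connected {K : ℕ} (ord : Fin K ≃ G.edgeSet) (hG : G.Connected) :
    Fintype.card V ≤ K + 1 ∧ K ≤ (Fintype.card V).choose 2 := by
  have hK : Fintype.card G.edgeSet = K := by rw [← Fintype.card_congr ord, Fintype.card_fin]
  constructor
  · have := hG.card_vert_le_card_edgeSet_add_one
    rwa [Nat.card_eq_fintype_card, Nat.card_eq_fintype_card, hK] at this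
  · have := G.card_edgeFinset_le_card_choose_two
    rwa [SimpleGraph.edgeFinset_card, hK] at this

variable {d : ℕ}

theorem sum_column {K : ℕ} (ord : Fin K ≃ G.edgeSet) (h : G.edgeSet → Op V d) :
    ∑ i, h (ord (column K i)) = (2 : ℂ) • hamiltonian h := by
  have h1 : ∑ k, h (ord k) = hamiltonian h := ord.sum_comp h
  rw [Fin.sum_univ_add, two_smul]
  simp only [column, Fin.addCases_left, Fin.addCases_right, id]
  rw [h1]
  congr 1
  rw [← h1]
  exact Equiv.sum_comp (Fin.revPerm (n := K)) fun k => h (ord k)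

variable [DecidableEq V]

theorem traceNorm_gibbs_sub_truncatedTrotter_le {K : ℕ} (ord : Fin K ≃ G.edgeSet)
    {h : G.edgeSet → Op V d} (hh : IsInteraction G h) {β ε : ℝ} (hβ : 0 ≤ β) (hε : 0 < ε)
    (hε1 : ε ≤ 1) {k M L : ℕ} (hM : M = 2 ^ (k + 1)) (hM1 : 2 * β * K ≤ M)
    (hM2 : 32 * β ^ 2 * K ^ 2 / ε ≤ M) (hL : 2 * K * Real.exp (10 * β - L) ≤ ε / 8) :
    traceNorm (gibbs β h - truncatedTrotter ord h β M L) ≤ ε * traceNorm (gibbs β h) := by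
  have hM0 : (0 : ℝ) < M := by rw [hM]; positivity
  have htM : β / M * M = β := div_mul_cancel₀ _ hM0.ne'
  have key := traceNorm_exp_sub_sum_light_le (g := fun i => h (ord (column K i)))
    (H := hamiltonian h) (t := β / M) (k := k) (M := M) (L := L) (ε := ε)
    (fun i => (hh _).2.2) (sum_column ord h) (isHermitian_hamiltonian hh) (by positivity)
    (by
      rw [div_mul_eq_mul_div, div_le_one hM0]
      push_cast; linarith)
    hM hε1
    (by
      rw [div_le_iff₀ hε] at hM2
      have e : (M : ℝ) * (β / M * ((K + K : ℕ) : ℝ)) ^ 2 = 4 * β ^ 2 * K ^ 2 / M := by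
        field_simp; push_cast; ring
      rw [e, div_le_iff₀ hM0]
      linarith)
    (by
      rw [htM]
      push_cast; linarith)
  rw [htM] at key
  have e : β / (M : ℝ) / 2 = β / (2 * M) := by rw [div_div, mul_comm (M : ℝ)]
  rw [e] at key
  exact key

/-- The constant in the bounds on the number of Trotter steps and on the truncation order. -/
def trotterConst (b : ℝ) : ℝ := 11 + 28 * b + 256 * b ^ 2

theorem one_le_trotterConst {b : ℝ} (hb : 0 ≤ b) : 1 ≤ trotterConst b := by
  unfold trotterConst; nlinarith [sq_nonneg b]

/-- For a connected graph `N ≤ K + 1` and `K ≤ N²`, so `log (N/ε)` and `log (K/ε)` agree up to a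
factor `2`. -/
theorem log_comparison {K N : ℕ} {ε : ℝ} (hK : 2 ≤ K) (hN1 : N ≤ K + 1) (hN2 : K ≤ N.choose 2)
    (hε : 0 < ε) (hε1 : ε ≤ 1) :
    2 ≤ (K : ℝ) / ε ∧ Real.log 2 ≤ Real.log (K / ε) ∧
      Real.log (N / ε) ≤ 2 * Real.log (K / ε) ∧ Real.log (K / ε) ≤ 2 * Real.log (N / ε) := by
  have hK2 : (2 : ℝ) ≤ K := by exact_mod_cast hK
  have hKr : (K : ℝ) ≤ K / ε := by rw [le_div_iff₀ hε]; nlinarith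
  have hr2 : 2 ≤ (K : ℝ) / ε := hK2.trans hKr
  have hN0 : 0 < N := by
    rcases Nat.eq_zero_or_pos N with h0 | h0
    · rw [h0] at hN2; simp at hN2; omega
    · exact h0
  have hN0' : (0 : ℝ) < N := by exact_mod_cast hN0
  refine ⟨hr2, Real.log_le_log (by norm_num) hr2, ?_, ?_⟩
  · have h1 : (N : ℝ) ≤ K + 1 := by exact_mod_cast hN1
    have hNr : (N : ℝ) / ε ≤ (K / ε) ^ 2 := by
      calc (N : ℝ) / ε ≤ (2 * K) / ε := by gcongr; linarith
        _ = 2 * (K / ε) := by ring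
        _ ≤ (K / ε) ^ 2 := by nlinarith
    have := Real.log_le_log (by positivity) hNr
    rwa [Real.log_pow] at this
  · have h1 : (K : ℝ) ≤ (N : ℝ) ^ 2 := by
      exact_mod_cast hN2.trans (Nat.choose_le_pow _ _)
    have hrN : (K : ℝ) / ε ≤ ((N : ℝ) / ε) ^ 2 := by
      rw [div_pow, div_le_div_iff₀ hε (by positivity)]
      have h2 : ε ^ 2 ≤ ε := by nlinarith
      exact mul_le_mul h1 h2 (by positivity) (by positivity)
    have := Real.log_le_log (by positivity) hrN
    rwa [Real.log_pow] at this

theorem exists_trotter_steps {b K r ε β : ℝ} (hb : 0 ≤ b) (hr1 : 1 ≤ r) (hK : 0 < K) (hε : 0 < ε)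
    (hr : r = K / ε) (hKr : K ≤ r) (hβ : 0 ≤ β) (hβr : β ≤ 2 * b * r) :
    ∃ k : ℕ, 2 * β * K ≤ (2 ^ (k + 1) : ℕ) ∧ 32 * β ^ 2 * K ^ 2 / ε ≤ (2 ^ (k + 1) : ℕ) ∧
      ((2 ^ (k + 1) : ℕ) : ℝ) ≤ trotterConst b * r ^ 4 := by
  have h0 : 0 ≤ 32 * β ^ 2 * K ^ 2 / ε := by positivity
  have h0' : 0 ≤ 2 * β * K := by positivity
  -- The number of steps is the power of two just above this sum, at most twice it. The terms ensure
  -- `tm ≤ 1` and, as `M (tm)^2 = 4β²K²/M`, a Trotter error parameter of at most `ε/8`.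
  obtain ⟨k, hk1, hk2⟩ := exists_nat_pow_near
    (show 1 ≤ 2 + 2 * β * K + 32 * β ^ 2 * K ^ 2 / ε by linarith) (by norm_num : (1 : ℝ) < 2)
  have e1 : 32 * β ^ 2 * K ^ 2 / ε = 32 * β ^ 2 * (K * r) := by rw [hr]; ring
  have h1 : 2 * β * K ≤ 4 * b * r ^ 4 := by
    calc 2 * β * K ≤ 2 * (2 * b * r) * r := by gcongr
      _ = 4 * b * r ^ 2 := by ring
      _ ≤ 4 * b * r ^ 4 := by gcongr; norm_num
  have h2 : 32 * β ^ 2 * (K * r) ≤ 128 * b ^ 2 * r ^ 4 := by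
    calc 32 * β ^ 2 * (K * r) ≤ 32 * (2 * b * r) ^ 2 * (r * r) := by gcongr
      _ = 128 * b ^ 2 * r ^ 4 := by ring
  have h3 : 1 ≤ r ^ 4 := one_le_pow₀ hr1
  refine ⟨k, by push_cast; linarith, by push_cast; linarith, ?_⟩
  have h4 : 2 * (2 + 4 * b + 128 * b ^ 2) * r ^ 4 ≤ trotterConst b * r ^ 4 :=
    mul_le_mul_of_nonneg_right (by unfold trotterConst; linarith) (by linarith)
  push_cast
  rw [pow_succ]
  linarith

theorem exists_truncation_order {b r β : ℝ} (hb : 0 ≤ b) (hr : 2 ≤ r) (hβ : 0 ≤ β)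
    (hβr : β ≤ 2 * b * Real.log r) :
    ∃ L : ℕ, 2 ≤ L ∧ (L : ℝ) ≤ trotterConst b * Real.log r ∧
      Real.exp (10 * β - L) ≤ (16 * r)⁻¹ := by
  have hr0 : 0 < r := by linarith
  have hlog2 := Real.log_two_gt_d9
  have hΛ2 : Real.log 2 ≤ Real.log r := Real.log_le_log (by norm_num) hr
  have hlog16 : Real.log (16 * r) = 4 * Real.log 2 + Real.log r := by
    rw [Real.log_mul (by norm_num) hr0.ne', show (16 : ℝ) = 2 ^ 4 by norm_num, Real.log_pow]
    norm_num
  have hL1 : 10 * β + Real.log (16 * r) ≤ ⌈10 * β + Real.log (16 * r)⌉₊ := Nat.le_ceil _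
  have h1 : (⌈10 * β + Real.log (16 * r)⌉₊ : ℝ) < 10 * β + Real.log (16 * r) + 1 :=
    Nat.ceil_lt_add_one (by rw [hlog16]; linarith)
  -- With `r = K/ε` this makes `2K e^{10β-L} ≤ 2K/(16r) = ε/8`.
  refine ⟨⌈10 * β + Real.log (16 * r)⌉₊, ?_, ?_, ?_⟩
  · have : (1 : ℝ) < ⌈10 * β + Real.log (16 * r)⌉₊ := by linarith
    exact_mod_cast this
  · have h2 : (20 * b + 7) * Real.log r ≤ trotterConst b * Real.log r :=
      mul_le_mul_of_nonneg_right (by unfold trotterConst; nlinarith [sq_nonneg b]) (by linarith)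
    linarith
  · rw [← Real.exp_log (show (0 : ℝ) < (16 * r)⁻¹ by positivity), Real.log_inv, Real.exp_le_exp]
    linarith

theorem bondDimension_le_exp {C Λ ℓ a r : ℝ} {d s M L D : ℕ} (hC : 1 ≤ C) (ha : 0 ≤ a)
    (ha' : (d : ℝ) ^ 2 * C = Real.exp a) (hr : r = Real.exp Λ) (hΛ1 : 1 ≤ 2 * Λ)
    (hΛℓ : Λ ≤ 2 * ℓ) (hs : s ≤ d ^ 2) (hM : (M : ℝ) ≤ C * r ^ 4) (hL : (L : ℝ) ≤ C * Λ)
    (hD : D ≤ L ^ 2 * (s * M) ^ (2 * L)) :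
    (D : ℝ) ≤ Real.exp (4 * (C * (12 + 4 * a)) * ℓ ^ 2) := by
  have hΛ0 : 0 ≤ Λ := by linarith
  have hsM : ((s * M : ℕ) : ℝ) ≤ Real.exp ((2 * a + 4) * Λ) := by
    have h1 : (s : ℝ) ≤ (d : ℝ) ^ 2 := by exact_mod_cast hs
    calc ((s * M : ℕ) : ℝ) ≤ (d : ℝ) ^ 2 * (C * r ^ 4) := by
          push_cast; exact mul_le_mul h1 hM (by positivity) (by positivity)
      _ = Real.exp (a + (4 : ℕ) * Λ) := by
          rw [Real.exp_add, ← ha', Real.exp_nat_mul, ← hr, mul_assoc]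
      _ ≤ _ := by
          rw [Real.exp_le_exp]
          push_cast
          nlinarith
  have hLe : (L : ℝ) ≤ Real.exp L := by linarith [Real.add_one_le_exp (L : ℝ)]
  have hD3 : (D : ℝ) ≤ (L : ℝ) ^ 2 * ((s * M : ℕ) : ℝ) ^ (2 * L) := by exact_mod_cast hD
  calc (D : ℝ) ≤ Real.exp L ^ 2 * Real.exp ((2 * a + 4) * Λ) ^ (2 * L) :=
        hD3.trans (mul_le_mul (pow_le_pow_left₀ (by positivity) hLe _)
          (pow_le_pow_left₀ (by positivity) hsM _) (by positivity) (by positivity))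
    _ = Real.exp (2 * L + 2 * L * ((2 * a + 4) * Λ)) := by
        rw [← Real.exp_nat_mul, ← Real.exp_nat_mul, ← Real.exp_add]
        push_cast; rfl
    -- Both `L` and `log (sM)` are of order `Λ = log r`, so the exponent is of order `Λ²`; the
    -- linear term is raised to second order by `1 ≤ 2Λ`, and `Λ ≤ 2ℓ` produces the prefactor `4`.
    _ ≤ _ := by
        rw [Real.exp_le_exp]
        have h0 : 2 * (L : ℝ) ≤ 2 * (C * Λ) := by linarith
        have h1 : 2 * (C * Λ) * 1 ≤ 2 * (C * Λ) * (2 * Λ) := by gcongr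
        have h2 : 2 * L * ((2 * a + 4) * Λ) ≤ 2 * (C * Λ) * ((2 * a + 4) * Λ) := by gcongr
        have h3 : Λ ^ 2 ≤ (2 * ℓ) ^ 2 := pow_le_pow_left₀ hΛ0 hΛℓ 2
        have h4 : C * (12 + 4 * a) * Λ ^ 2 ≤ C * (12 + 4 * a) * (2 * ℓ) ^ 2 := by gcongr
        linarith

/-- Approximation of Gibbs states at inverse temperatures up to `b log (N/ε)`. -/
theorem exists_truncatedTrotter_approx (b : ℝ) (hb : 0 ≤ b) : ∃ (C : ℝ) (p : ℕ), 0 < C ∧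
    ∀ d : ℕ, 1 ≤ d → ∃ C' : ℝ, 0 < C' ∧
    ∀ (V : Type u) [Fintype V] [DecidableEq V] (G : SimpleGraph V) [DecidableRel G.Adj]
      (K : ℕ) (ord : Fin K ≃ G.edgeSet) (h : G.edgeSet → Op V d) (β ε : ℝ),
      G.Connected → 2 ≤ K → IsInteraction G h →
      0 ≤ β → β ≤ b * Real.log (Fintype.card V / ε) → 0 < ε → ε ≤ 1 →
      ∃ M L : ℕ, 1 ≤ M ∧ (M : ℝ) ≤ C * (K / ε) ^ p ∧ (L : ℝ) ≤ C * Real.log (K / ε) ∧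
        traceNorm (gibbs β h - truncatedTrotter ord h β M L) ≤ ε * traceNorm (gibbs β h) ∧
        (∀ i, SchmidtRankLE (ord (column K i) : Sym2 V) (d ^ 2) (trotterTerm ord h β M i)) ∧
        ∀ s : ℕ, 1 ≤ s → s ≤ d ^ 2 →
          (∀ i, SchmidtRankLE (ord (column K i) : Sym2 V) s (trotterTerm ord h β M i)) →
          ∃ D : ℕ, IsPEPO G D (truncatedTrotter ord h β M L) ∧
            D ≤ L ^ 2 * (s * M) ^ (2 * L) ∧
            (D : ℝ) ≤ Real.exp (C' * Real.log (Fintype.card V / ε) ^ 2) := by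
  have hC1 := one_le_trotterConst hb
  refine ⟨trotterConst b, 4, by linarith, fun d hd => ?_⟩
  have hd1 : (1 : ℝ) ≤ d := by exact_mod_cast hd
  have hdC : 1 ≤ (d : ℝ) ^ 2 * trotterConst b :=
    one_le_mul_of_one_le_of_one_le (one_le_pow₀ hd1) hC1
  have ha0 : 0 ≤ Real.log ((d : ℝ) ^ 2 * trotterConst b) := Real.log_nonneg hdC
  refine ⟨4 * (trotterConst b * (12 + 4 * Real.log ((d : ℝ) ^ 2 * trotterConst b))),
    by positivity, ?_⟩
  intro V _ _ G _ K ord h β ε hG hK hh hβ hβb hε hε1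
  obtain ⟨hN1, hN2⟩ := card_le_of_connected ord hG
  obtain ⟨hr2, hΛ2, hℓΛ, hΛℓ⟩ := log_comparison hK hN1 hN2 hε hε1
  have hK0 : (0 : ℝ) < K := by exact_mod_cast (by omega : 0 < K)
  have hr0 : 0 < (K : ℝ) / ε := by positivity
  have hKr : (K : ℝ) ≤ K / ε := by rw [le_div_iff₀ hε]; nlinarith
  have hβΛ : β ≤ 2 * b * Real.log (K / ε) := by
    linarith [mul_le_mul_of_nonneg_left hℓΛ hb]
  have hβr : β ≤ 2 * b * (K / ε) := hβΛ.trans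
    (mul_le_mul_of_nonneg_left (Real.log_le_self hr0.le) (by positivity))
  obtain ⟨k, hM1, hM2, hMC⟩ := exists_trotter_steps hb (by linarith) hK0 hε rfl hKr hβ hβr
  obtain ⟨L, hL2, hLΛ, hLe⟩ := exists_truncation_order hb hr2 hβ hβΛ
  have hM : 2 ≤ 2 ^ (k + 1) := by
    rw [pow_succ]; have := Nat.one_le_two_pow (n := k); omega
  refine ⟨2 ^ (k + 1), L, by omega, hMC, hLΛ, ?_, schmidtRankLE_trotterTerm ord hh β _, ?_⟩
  · refine traceNorm_gibbs_sub_truncatedTrotter_le ord hh hβ hε hε1 rfl hM1 hM2 ?_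
    calc 2 * K * Real.exp (10 * β - L) ≤ 2 * K * (16 * (K / ε))⁻¹ := by gcongr
      _ = ε / 8 := by field_simp; norm_num
  · intro s hs1 hs2 hs
    obtain ⟨D, hD1, hD2⟩ := exists_isPEPO_truncatedTrotter (L := L) ord h β hL2
      (le_trans hM (Nat.le_mul_of_pos_left _ hs1)) hs
    have hlog2 := Real.log_two_gt_d9
    exact ⟨D, hD1, hD2, bondDimension_le_exp hC1 ha0 (Real.exp_log (by linarith)).symm
      (Real.exp_log hr0).symm (by linarith) hΛℓ hs2 hMC hLΛ hD2⟩

end Gibbs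

/-! ### Spectral decomposition of the exponential. -/

section Spectral

variable {n : Type*} [Fintype n]

theorem norm_toLp_eq_one {v : n → ℂ} (hv : star v ⬝ᵥ v = 1) : ‖WithLp.toLp 2 v‖ = 1 := by
  have h : (inner ℂ (WithLp.toLp 2 v) (WithLp.toLp 2 v) : ℂ) = 1 := by
    rw [EuclideanSpace.inner_eq_star_dotProduct, dotProduct_comm]; exact hv
  have h' := inner_self_eq_norm_sq (𝕜 := ℂ) (WithLp.toLp 2 v)
  rw [h] at h'
  exact (pow_eq_one_iff_of_nonneg (norm_nonneg _) two_ne_zero).1 (by simpa using h'.symm)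

variable [DecidableEq n] {H : Matrix n n ℂ}

theorem star_eigenvectorBasis_dotProduct (hH : H.IsHermitian) (i j : n) :
    star (hH.eigenvectorBasis i).ofLp ⬝ᵥ (hH.eigenvectorBasis j).ofLp = if i = j then 1 else 0 := by
  have := orthonormal_iff_ite.1 hH.eigenvectorBasis.orthonormal i j
  rwa [EuclideanSpace.inner_eq_star_dotProduct, dotProduct_comm] at this

theorem exp_smul_eq_sum (hH : H.IsHermitian) (c : ℝ) :
    NormedSpace.exp ((c : ℂ) • H) = ∑ i, ((Real.exp (c * hH.eigenvalues i) : ℝ) : ℂ) •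
      Matrix.vecMulVec (hH.eigenvectorBasis i).ofLp (star (hH.eigenvectorBasis i).ofLp) := by
  set W : Matrix n n ℂ := (hH.eigenvectorUnitary).1
  have hW : Wᴴ * W = 1 := Unitary.coe_star_mul_self hH.eigenvectorUnitary
  have hinv : W⁻¹ = Wᴴ := Matrix.inv_eq_left_inv hW
  have hunit : IsUnit W := (Matrix.isUnit_iff_isUnit_det _).2 (Matrix.isUnit_det_of_left_inverse hW)
  have h1 : (c : ℂ) • H =
      W * Matrix.diagonal (fun i => ((c * hH.eigenvalues i : ℝ) : ℂ)) * W⁻¹ := by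
    conv_lhs => rw [hH.spectral_theorem, Unitary.conjStarAlgAut_apply]
    rw [hinv]
    change (c : ℂ) • (W * Matrix.diagonal _ * Wᴴ) = _
    rw [← Matrix.smul_mul, ← Matrix.mul_smul, ← Matrix.diagonal_smul]
    congr 3
    ext i
    simp
  rw [h1, Matrix.exp_conj _ _ hunit, Matrix.exp_diagonal, hinv]
  ext a b
  rw [Matrix.sum_apply, Matrix.mul_apply]
  refine Finset.sum_congr rfl fun i _ => ?_
  rw [Matrix.mul_diagonal, Matrix.smul_apply, Matrix.vecMulVec_apply, Pi.coe_exp,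
    ← Complex.exp_eq_exp_ℂ, ← Complex.ofReal_exp, smul_eq_mul]
  change W a i * _ * star (W b i) = _
  rw [mul_comm (W a i), mul_assoc]
  rfl

theorem traceNorm_vecMulVec_le_one {v : n → ℂ} (hv : star v ⬝ᵥ v = 1) :
    traceNorm (Matrix.vecMulVec v (star v)) ≤ 1 := by
  have hn := norm_toLp_eq_one hv
  refine traceNorm_le_of_forall fun U hU => ?_
  rw [Matrix.mul_vecMulVec, Matrix.trace_vecMulVec]
  have h : U *ᵥ v ⬝ᵥ star v = inner ℂ (WithLp.toLp 2 v) (WithLp.toLp 2 (U *ᵥ v)) := by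
    rw [EuclideanSpace.inner_eq_star_dotProduct]
  rw [h]
  refine (norm_inner_le_norm _ _).trans ?_
  rw [hn, one_mul]
  refine (Matrix.l2_opNorm_mulVec U (WithLp.toLp 2 v)).trans ?_
  rw [hn, mul_one]
  exact hU

end Spectral

/-! ### Gapped ground states. -/

section GroundState

variable {V : Type u} [Fintype V] [DecidableEq V] {d : ℕ}

/-- A gapped ground state is one of the eigenvectors of the spectral decomposition. -/
theorem IsGappedGroundState.exists_index {A : Op V d} (hA : A.IsHermitian)
    {Ψ : (V → Fin d) → ℂ} {E₀ Δ : ℝ} (hΔ : 0 < Δ) (hΨ : IsGappedGroundState A Ψ E₀ Δ) :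
    ∃ i₀, hA.eigenvalues i₀ = E₀ ∧ (∀ i, i ≠ i₀ → E₀ + Δ ≤ hA.eigenvalues i) ∧
      Matrix.vecMulVec (hA.eigenvectorBasis i₀).ofLp (star (hA.eigenvectorBasis i₀).ofLp) =
        Matrix.vecMulVec Ψ (star Ψ) := by
  obtain ⟨h1, hE, hgap⟩ := hΨ
  set b : (V → Fin d) → (V → Fin d) → ℂ := fun i => (hA.eigenvectorBasis i).ofLp
  have hAb : ∀ i, A *ᵥ b i = (hA.eigenvalues i : ℂ) • b i := fun i => by
    have := hA.mulVec_eigenvectorBasis i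
    simpa [b] using this
  have hbb : ∀ i j, star (b i) ⬝ᵥ b j = if i = j then 1 else 0 :=
    star_eigenvectorBasis_dotProduct hA
  have hb0 : ∀ i, b i ≠ 0 := fun i h0 => by
    have := hbb i i
    rw [h0] at this
    simp at this
  obtain ⟨i₀, hi₀⟩ : ∃ i, star Ψ ⬝ᵥ b i ≠ 0 := by
    by_contra! hall
    have : (WithLp.toLp 2 Ψ : EuclideanSpace ℂ (V → Fin d)) = 0 := by
      rw [← hA.eigenvectorBasis.sum_repr' (WithLp.toLp 2 Ψ)]
      refine Finset.sum_eq_zero fun i _ => ?_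
      have h0 : (inner ℂ (WithLp.toLp 2 Ψ) (hA.eigenvectorBasis i) : ℂ) = 0 := by
        rw [EuclideanSpace.inner_eq_star_dotProduct, dotProduct_comm]; exact hall i
      rw [← inner_conj_symm, h0, map_zero, zero_smul]
    have h0 : Ψ = 0 := congrArg WithLp.ofLp this
    rw [h0] at h1
    simp at h1
  have hΨA : ∀ φ, star Ψ ⬝ᵥ (A *ᵥ φ) = E₀ * (star Ψ ⬝ᵥ φ) := fun φ => by
    have h2 : star Ψ ᵥ* A = star (A *ᵥ Ψ) := by
      rw [Matrix.star_mulVec, hA.eq]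
    rw [Matrix.dotProduct_mulVec, h2, hE, star_smul, smul_dotProduct]
    simp
  -- Eigenvectors of a Hermitian matrix with nonzero overlap have equal eigenvalues.
  have hEi₀ : hA.eigenvalues i₀ = E₀ := by
    have h2 := hΨA (b i₀)
    rw [hAb, dotProduct_smul, smul_eq_mul] at h2
    exact Complex.ofReal_injective (mul_right_cancel₀ hi₀ h2)
  set c := star Ψ ⬝ᵥ b i₀
  -- Otherwise the part of `b i₀` orthogonal to `Ψ` would be an eigenvector of energy `E₀`, against
  -- the gap. The factor `c` is then a phase, which drops out of the projection.
  have hbΨ : b i₀ = c • Ψ := by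
    by_contra hne
    have h2 : b i₀ - c • Ψ ≠ 0 := sub_ne_zero.2 hne
    have h3 : star Ψ ⬝ᵥ (b i₀ - c • Ψ) = 0 := by
      rw [dotProduct_sub, dotProduct_smul, h1, smul_eq_mul, mul_one]
      exact sub_self c
    have h4 : A *ᵥ (b i₀ - c • Ψ) = (E₀ : ℂ) • (b i₀ - c • Ψ) := by
      rw [Matrix.mulVec_sub, Matrix.mulVec_smul, hE, hAb, hEi₀, smul_sub, smul_comm c]
    have := hgap _ E₀ h2 h3 h4
    linarith
  have hc : c * star c = 1 := by
    have h2 := hbb i₀ i₀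
    rw [if_pos rfl, hbΨ, star_smul, smul_dotProduct, dotProduct_smul, h1] at h2
    simp only [smul_eq_mul, mul_one] at h2
    rw [mul_comm]; exact h2
  refine ⟨i₀, hEi₀, fun i hi => ?_, ?_⟩
  · refine hgap (b i) _ (hb0 i) ?_ (hAb i)
    have h2 := hbb i₀ i
    rw [if_neg hi.symm, hbΨ, star_smul, smul_dotProduct, smul_eq_mul] at h2
    refine (mul_eq_zero.1 h2).resolve_left fun h0 => ?_
    rw [h0, mul_zero] at hc
    exact zero_ne_one hc
  · change Matrix.vecMulVec (b i₀) (star (b i₀)) = _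
    rw [hbΨ, star_smul, Matrix.smul_vecMulVec, Matrix.vecMulVec_smul, smul_smul, hc, one_smul]

/-- Interpolates between `y ≥ ⌊y⌋₊` and `y ≥ Δ`, so that the lowest energy band also receives a
positive power of the Boltzmann factor. -/
theorem mul_floor_add_one_le {Δ y : ℝ} (hΔ : 0 < Δ) (hy : Δ ≤ y) :
    Δ / (1 + Δ) * (⌊y⌋₊ + 1) ≤ y := by
  have hf : (⌊y⌋₊ : ℝ) ≤ y := Nat.floor_le (hΔ.le.trans hy)
  rw [div_mul_eq_mul_div, div_le_iff₀ (by linarith)]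
  nlinarith

theorem sum_pow_succ_le {w : ℝ} (hw0 : 0 ≤ w) (hw : w ≤ 1 / 2) (R : ℕ) :
    ∑ m ∈ Finset.range R, w ^ (m + 1) ≤ 2 * w := by
  have h1 : ∑ m ∈ Finset.range R, w ^ m ≤ (1 - w)⁻¹ := by
    rw [← tsum_geometric_of_lt_one hw0 (by linarith)]
    exact (summable_geometric_of_lt_one hw0 (by linarith)).sum_le_tsum _ fun i _ => by positivity
  have h2 : (1 - w)⁻¹ ≤ 2 := by
    rw [inv_le_comm₀ (by linarith) (by norm_num)]; linarith
  simp only [pow_succ, ← Finset.sum_mul]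
  exact mul_le_mul_of_nonneg_right (h1.trans h2) hw0

/-- The weight of the excited states, from the bound on the number of levels. -/
theorem sum_exp_excited_le {A : Op V d} (hA : A.IsHermitian) {i₀ : V → Fin d} {E₀ Δ κ N β w : ℝ}
    (hΔ : 0 < Δ) (hκ : 0 ≤ κ) (hN : 1 ≤ N) (hβ : 0 ≤ β)
    (hgap : ∀ i, i ≠ i₀ → E₀ + Δ ≤ hA.eigenvalues i)
    (hcount : ∀ E : ℝ, 0 ≤ E → (levelCount hA (E₀ + E) : ℝ) ≤ N ^ (κ * (1 + E)))
    (hw : N ^ (2 * κ) * Real.exp (-(β * (Δ / (1 + Δ)))) ≤ w) (hw2 : w ≤ 1 / 2) :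
    ∑ i ∈ Finset.univ.erase i₀, Real.exp (-(β * (hA.eigenvalues i - E₀))) ≤ 2 * w := by
  set y : (V → Fin d) → ℝ := fun i => hA.eigenvalues i - E₀
  have hy : ∀ i ∈ Finset.univ.erase i₀, Δ ≤ y i := fun i hi => by
    have := hgap i (Finset.ne_of_mem_erase hi)
    simp only [y]; linarith
  obtain ⟨R, hR⟩ : ∃ R, ∀ i ∈ Finset.univ.erase i₀, ⌊y i⌋₊ ∈ Finset.range R :=
    ⟨Finset.univ.sup (fun i => ⌊y i⌋₊) + 1, fun i _ => Finset.mem_range.2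
      (Nat.lt_succ_of_le (Finset.le_sup (f := fun i => ⌊y i⌋₊) (Finset.mem_univ i)))⟩
  have hN0 : 0 < N := by linarith
  have hw0 : 0 ≤ w := le_trans (by positivity) hw
  rw [← Finset.sum_fiberwise_of_maps_to hR]
  -- Excitation energies in `[m, m + 1)` form one band. It has at most `N^{κ(m+2)} ≤ N^{2κ(m+1)}`
  -- levels, each of weight at most `q^{m+1}`, so the bands are dominated by a geometric series in
  -- `w`.
  refine (Finset.sum_le_sum fun m _ => ?_).trans (sum_pow_succ_le hw0 hw2 R)
  set q := Real.exp (-(β * (Δ / (1 + Δ))))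
  have h1 : ∀ i ∈ (Finset.univ.erase i₀).filter fun i => ⌊y i⌋₊ = m,
      Real.exp (-(β * y i)) ≤ q ^ (m + 1) := fun i hi => by
    obtain ⟨hi1, hi2⟩ := Finset.mem_filter.1 hi
    have h2 := mul_floor_add_one_le hΔ (hy i hi1)
    rw [hi2] at h2
    rw [← Real.exp_nat_mul, Real.exp_le_exp]
    have := mul_le_mul_of_nonneg_left h2 hβ
    push_cast
    linarith
  have h2 : (((Finset.univ.erase i₀).filter fun i => ⌊y i⌋₊ = m).card : ℝ) ≤
      (N ^ (2 * κ)) ^ (m + 1) := by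
    have h3 : ((Finset.univ.erase i₀).filter fun i => ⌊y i⌋₊ = m).card ≤
        levelCount hA (E₀ + (m + 1)) := by
      refine Finset.card_le_card fun i hi => ?_
      obtain ⟨hi1, hi2⟩ := Finset.mem_filter.1 hi
      refine Finset.mem_filter.2 ⟨Finset.mem_univ _, ?_⟩
      have h4 := Nat.lt_floor_add_one (y i)
      rw [hi2] at h4
      simp only [y] at h4
      linarith
    have h5 : (levelCount hA (E₀ + (m + 1)) : ℝ) ≤ N ^ (κ * (1 + (m + 1))) :=
      hcount _ (by positivity)
    refine (Nat.cast_le.2 h3).trans (h5.trans ?_)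
    rw [← Real.rpow_natCast, ← Real.rpow_mul hN0.le]
    refine Real.rpow_le_rpow_of_exponent_le hN ?_
    push_cast
    have : 0 ≤ κ * m := by positivity
    nlinarith
  calc _ ≤ ∑ i ∈ (Finset.univ.erase i₀).filter fun i => ⌊y i⌋₊ = m, q ^ (m + 1) :=
        Finset.sum_le_sum h1
    _ ≤ (N ^ (2 * κ)) ^ (m + 1) * q ^ (m + 1) := by
        rw [Finset.sum_const, nsmul_eq_mul]
        exact mul_le_mul_of_nonneg_right h2 (by positivity)
    _ ≤ w ^ (m + 1) := by
        rw [← mul_pow]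
        exact pow_le_pow_left₀ (by positivity) hw _

/-- Distance of the rescaled Gibbs state from the ground state projection. -/
theorem traceNorm_projection_sub_gibbs_le {G : SimpleGraph V} [DecidableRel G.Adj]
    {h : G.edgeSet → Op V d} (hH : (hamiltonian h).IsHermitian) {Ψ : (V → Fin d) → ℂ}
    {i₀ : V → Fin d} {E₀ β : ℝ} (hE : hH.eigenvalues i₀ = E₀)
    (hΨ : Matrix.vecMulVec (hH.eigenvectorBasis i₀).ofLp (star (hH.eigenvectorBasis i₀).ofLp) =
      Matrix.vecMulVec Ψ (star Ψ)) :
    traceNorm (Matrix.vecMulVec Ψ (star Ψ) - ((Real.exp (β * E₀) : ℝ) : ℂ) • gibbs β h) ≤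
      ∑ i ∈ Finset.univ.erase i₀, Real.exp (-(β * (hH.eigenvalues i - E₀))) := by
  set P : (V → Fin d) → Op V d := fun i =>
    Matrix.vecMulVec (hH.eigenvectorBasis i).ofLp (star (hH.eigenvectorBasis i).ofLp)
  have h1 : ((Real.exp (β * E₀) : ℝ) : ℂ) • gibbs β h =
      ∑ i, ((Real.exp (-(β * (hH.eigenvalues i - E₀))) : ℝ) : ℂ) • P i := by
    rw [gibbs, exp_smul_eq_sum hH, Finset.smul_sum]
    refine Finset.sum_congr rfl fun i _ => ?_
    rw [smul_smul, ← Complex.ofReal_mul, ← Real.exp_add]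
    congr 3
    ring
  rw [h1, ← Finset.add_sum_erase _ _ (Finset.mem_univ i₀), hE, sub_self, mul_zero, neg_zero,
    Real.exp_zero, Complex.ofReal_one, one_smul, ← hΨ, ← sub_sub, sub_self, zero_sub,
    ← Finset.sum_neg_distrib]
  refine (traceNorm_sum_le _ _).trans (Finset.sum_le_sum fun i _ => ?_)
  rw [← neg_smul]
  refine (traceNorm_smul_le _ _).trans ?_
  rw [norm_neg, Complex.norm_real, Real.norm_of_nonneg (Real.exp_nonneg _)]
  refine mul_le_of_le_one_right (Real.exp_nonneg _) (traceNorm_vecMulVec_le_one ?_)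
  rw [star_eigenvectorBasis_dotProduct, if_pos rfl]

/-- Some rescaled column of an operator close to `|Ψ⟩⟨Ψ|` is close to `Ψ`. -/
theorem exists_column_close {n : Type*} [Fintype n] [DecidableEq n] {Ψ : n → ℂ}
    (hΨ : star Ψ ⬝ᵥ Ψ = 1) {σ : Matrix n n ℂ} {ε : ℝ}
    (h : traceNorm (Matrix.vecMulVec Ψ (star Ψ) - σ) ≤ ε) :
    ∃ (τ : n) (z : ℂ), ‖WithLp.toLp 2 (Ψ - fun p => z * σ p τ)‖ ≤ ε := by
  have hε : 0 ≤ ε := (traceNorm_nonneg _).trans h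
  set D := Matrix.vecMulVec Ψ (star Ψ) - σ
  have h1 : ∑ τ, ∑ p, ‖D p τ‖ ^ 2 ≤ ε ^ 2 := by
    rw [Finset.sum_comm]
    exact (sum_norm_sq_le_traceNorm_sq D).trans (pow_le_pow_left₀ (traceNorm_nonneg _) h 2)
  have h2 : ∑ τ, ‖Ψ τ‖ ^ 2 = 1 := by
    have := norm_toLp_eq_one hΨ
    have h3 := EuclideanSpace.norm_sq_eq (WithLp.toLp 2 Ψ)
    rw [this, one_pow] at h3
    exact h3.symm
  -- Averaging: the squared column norms of `D` sum to at most `ε² = ε² ∑ ‖Ψ τ‖²`, so the inequality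
  -- holds for some column with `Ψ τ ≠ 0`.
  obtain ⟨τ, hτ0, hτ⟩ : ∃ τ, Ψ τ ≠ 0 ∧ ∑ p, ‖D p τ‖ ^ 2 ≤ ε ^ 2 * ‖Ψ τ‖ ^ 2 := by
    by_contra! hall
    obtain ⟨τ₀, hτ₀⟩ : ∃ τ, Ψ τ ≠ 0 := by
      by_contra! h0
      simp [h0] at h2
    have h3 : ∑ τ, ε ^ 2 * ‖Ψ τ‖ ^ 2 < ∑ τ, ∑ p, ‖D p τ‖ ^ 2 := by
      refine Finset.sum_lt_sum (fun τ _ => ?_) ⟨τ₀, Finset.mem_univ _, hall τ₀ hτ₀⟩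
      by_cases h0 : Ψ τ = 0
      · rw [h0, norm_zero]
        simp only [ne_eq, OfNat.ofNat_ne_zero, not_false_eq_true, zero_pow, mul_zero]
        positivity
      · exact (hall τ h0).le
    rw [← Finset.mul_sum, h2, mul_one] at h3
    linarith
  -- Column `τ` of `|Ψ⟩⟨Ψ|` is `star (Ψ τ)` times `Ψ`.
  refine ⟨τ, (star (Ψ τ))⁻¹, ?_⟩
  refine le_of_pow_le_pow_left₀ two_ne_zero hε ?_
  rw [EuclideanSpace.norm_sq_eq]
  have hs0 : star (Ψ τ) ≠ 0 := star_ne_zero.2 hτ0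
  have h4 : ∀ p, Ψ p - (star (Ψ τ))⁻¹ * σ p τ = (star (Ψ τ))⁻¹ * D p τ := fun p => by
    simp only [D, Matrix.sub_apply, Matrix.vecMulVec_apply, Pi.star_apply]
    field_simp
  simp only [Pi.sub_apply, h4, norm_mul, norm_inv, norm_star, mul_pow, ← Finset.mul_sum]
  rw [inv_pow, inv_mul_le_iff₀ (by positivity), mul_comm]
  exact hτ

/-- Approximation of gapped ground states. -/
theorem exists_groundState_approx (d : ℕ) (Δ κ : ℝ) (hd : 1 ≤ d) (hΔ : 0 < Δ) (hκ : 0 ≤ κ) :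
    ∃ C : ℝ, 0 < C ∧
      ∀ (V : Type u) [Fintype V] [DecidableEq V] (G : SimpleGraph V) [DecidableRel G.Adj]
        (h : G.edgeSet → Op V d) (hh : IsInteraction G h) (Ψ : (V → Fin d) → ℂ) (E₀ ε : ℝ),
        G.Connected → 2 ≤ G.edgeFinset.card →
        IsGappedGroundState (hamiltonian h) Ψ E₀ Δ →
        (∀ E : ℝ, 0 ≤ E → (levelCount (isHermitian_hamiltonian hh) (E₀ + E) : ℝ) ≤
          (Fintype.card V : ℝ) ^ (κ * (1 + E))) →
        0 < ε → ε ≤ 1 →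
        ∃ D : ℕ, (D : ℝ) ≤ Real.exp (C * Real.log (Fintype.card V / ε) ^ 2) ∧
          (∃ σ : Op V d, IsPEPO G D σ ∧ traceNorm (Matrix.vecMulVec Ψ (star Ψ) - σ) ≤ ε) ∧
          ∃ Φ : (V → Fin d) → ℂ, IsPEPS G D Φ ∧ ‖WithLp.toLp 2 (Ψ - Φ)‖ ≤ ε := by
  set δ := Δ / (1 + Δ)
  have hδ : 0 < δ := by positivity
  -- The inverse temperature needed here grows with `log (1/ε)` as well, hence the Gibbs
  -- approximation for `β` up to `b log (N/ε)`.
  obtain ⟨C₁, p, -, hC₁⟩ := exists_truncatedTrotter_approx.{u} ((2 * κ + 1) / δ) (by positivity)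
  obtain ⟨C', hC', hmain⟩ := hC₁ d hd
  refine ⟨16 * C', by positivity, ?_⟩
  intro V _ _ G _ h hh Ψ E₀ ε hG hK hΨ hcount hε hε1
  have hH := isHermitian_hamiltonian hh
  set ord : Fin (Fintype.card G.edgeSet) ≃ G.edgeSet := (Fintype.equivFin _).symm
  rw [SimpleGraph.edgeFinset_card] at hK
  obtain ⟨hN1, hN2⟩ := card_le_of_connected ord hG
  have hN : 2 ≤ Fintype.card V := by
    by_contra! hlt
    have h0 : (Fintype.card V).choose 2 = 0 := Nat.choose_eq_zero_of_lt hlt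
    omega
  have : Nonempty V := hG.nonempty
  have hN' : (2 : ℝ) ≤ Fintype.card V := by exact_mod_cast hN
  replace hmain := hmain V G _ ord h
  generalize Fintype.card V = N at *
  have hNε : (2 : ℝ) ≤ N / ε := by rw [le_div_iff₀ hε]; nlinarith
  have hlog8 : Real.log (N / (ε / 8)) ≤ 4 * Real.log (N / ε) := by
    have e : (N : ℝ) / (ε / 8) = 2 ^ 3 * (N / ε) := by field_simp; norm_num
    rw [e, Real.log_mul (by norm_num) (by positivity), Real.log_pow]
    have := Real.log_le_log (by norm_num) hNε
    push_cast
    linarith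
  have hlogN : 0 ≤ Real.log N := Real.log_nonneg (by linarith)
  have hlogε : Real.log (ε / 8) ≤ 0 := Real.log_nonpos (by positivity) (by linarith)
  have hlogd : Real.log (N / (ε / 8)) = Real.log N - Real.log (ε / 8) :=
    Real.log_div (by positivity) (by positivity)
  -- Chosen so that `N^{2κ} e^{-βδ} = ε/8`, the ratio of the geometric series of excited weights.
  set β := (2 * κ * Real.log N - Real.log (ε / 8)) / δ with hβdef
  have hβ0 : 0 ≤ β := by
    have : 0 ≤ 2 * κ * Real.log N := by positivity
    exact div_nonneg (by linarith) hδ.le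
  have hβb : β ≤ (2 * κ + 1) / δ * Real.log (N / (ε / 8)) := by
    rw [hβdef, div_mul_eq_mul_div, hlogd]
    refine div_le_div_of_nonneg_right ?_ hδ.le
    nlinarith [mul_nonneg hκ (neg_nonneg.2 hlogε)]
  obtain ⟨M, L, -, -, -, herr, hrank, hpepo⟩ := hmain β (ε / 8) hG hK hh hβ0 hβb
    (by positivity) (by linarith)
  obtain ⟨D, hD, -, hDexp⟩ := hpepo (d ^ 2) (Nat.one_le_pow _ _ hd) le_rfl hrank
  obtain ⟨i₀, hE, hgap, hproj⟩ := hΨ.exists_index hH hΔ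
  have hw : (N : ℝ) ^ (2 * κ) * Real.exp (-(β * δ)) ≤ ε / 8 := by
    rw [hβdef, div_mul_cancel₀ _ hδ.ne', Real.rpow_def_of_pos (by linarith), ← Real.exp_add]
    refine le_of_eq ?_
    rw [show Real.log N * (2 * κ) + -(2 * κ * Real.log N - Real.log (ε / 8)) = Real.log (ε / 8) by
      ring, Real.exp_log (by positivity)]
  have hexc := sum_exp_excited_le hH hΔ hκ (by linarith) hβ0 hgap hcount hw (by linarith)
  have h1 := (traceNorm_projection_sub_gibbs_le (β := β) hH hE hproj).trans hexc
  set z : ℂ := ((Real.exp (β * E₀) : ℝ) : ℂ)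
  have hz : ‖z‖ = Real.exp (β * E₀) := by
    rw [Complex.norm_real, Real.norm_of_nonneg (Real.exp_nonneg _)]
  -- The rescaled Gibbs operator is within `ε/4` of a projection of trace norm at most one, so the
  -- relative error `ε/8` becomes an absolute error of at most `ε/4`.
  have h2 : Real.exp (β * E₀) * traceNorm (gibbs β h) ≤ 2 := by
    have e : gibbs β h = z⁻¹ • (Matrix.vecMulVec Ψ (star Ψ) -
        (Matrix.vecMulVec Ψ (star Ψ) - z • gibbs β h)) := by
      rw [sub_sub_cancel, smul_smul, inv_mul_cancel₀ (by simp [z]), one_smul]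
    have h3 : traceNorm (gibbs β h) ≤ ‖z⁻¹‖ * (1 + 2 * (ε / 8)) := by
      conv_lhs => rw [e]
      exact (traceNorm_smul_le _ _).trans (mul_le_mul_of_nonneg_left
        ((traceNorm_sub_le _ _).trans (add_le_add (traceNorm_vecMulVec_le_one hΨ.1) h1))
        (norm_nonneg _))
    rw [norm_inv, hz, inv_mul_eq_div, le_div_iff₀ (Real.exp_pos _)] at h3
    linarith
  have h4 : traceNorm (Matrix.vecMulVec Ψ (star Ψ) - z • truncatedTrotter ord h β M L) ≤ ε := by
    have e : Matrix.vecMulVec Ψ (star Ψ) - z • truncatedTrotter ord h β M L =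
        (Matrix.vecMulVec Ψ (star Ψ) - z • gibbs β h) +
          z • (gibbs β h - truncatedTrotter ord h β M L) := by
      rw [smul_sub]; abel
    rw [e]
    have h5 : traceNorm (z • (gibbs β h - truncatedTrotter ord h β M L)) ≤ ε / 8 * 2 := by
      refine (traceNorm_smul_le _ _).trans ?_
      rw [hz]
      calc _ ≤ Real.exp (β * E₀) * (ε / 8 * traceNorm (gibbs β h)) :=
            mul_le_mul_of_nonneg_left herr (Real.exp_nonneg _)
        _ = ε / 8 * (Real.exp (β * E₀) * traceNorm (gibbs β h)) := by ring
        _ ≤ _ := mul_le_mul_of_nonneg_left h2 (by positivity)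
    refine (traceNorm_add_le _ _).trans ((add_le_add h1 h5).trans ?_)
    linarith
  refine ⟨D, hDexp.trans ?_, ⟨_, hD.smul z, h4⟩, ?_⟩
  · rw [Real.exp_le_exp]
    have h5 : 0 ≤ Real.log (N / (ε / 8)) := by rw [hlogd]; linarith
    have h6 := pow_le_pow_left₀ h5 hlog8 2
    have h7 := mul_le_mul_of_nonneg_left h6 hC'.le
    linarith
  · obtain ⟨τ, y, hy⟩ := exists_column_close hΨ.1 h4
    exact ⟨_, ((hD.smul z).smul y).isPEPS_col τ, hy⟩

end GroundState

end

end GibbsPEPO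

theorem mainTheorem1 :
    (∀ b : ℝ, 0 ≤ b → ∃ (C : ℝ) (p : ℕ), 0 < C ∧
      ∀ d : ℕ, 1 ≤ d → ∃ C' : ℝ, 0 < C' ∧
      ∀ (V : Type u) [Fintype V] [DecidableEq V] (G : SimpleGraph V) [DecidableRel G.Adj]
        (z : ℕ) (γ : ℝ) (K : ℕ) (ord : Fin K ≃ G.edgeSet)
        (h : G.edgeSet → GibbsPEPO.Op V d) (β ε : ℝ),
        G.Connected → (∀ v, G.degree v < z) → GibbsPEPO.LatticeGrowthLE G γ → 2 ≤ K →
        GibbsPEPO.IsInteraction G h →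
        0 ≤ β → β ≤ b * Real.log (Fintype.card V) → 0 < ε → ε ≤ 1 →
        ∃ M L : ℕ, 1 ≤ M ∧ (M : ℝ) ≤ C * (K / ε) ^ p ∧ (L : ℝ) ≤ C * Real.log (K / ε) ∧
          GibbsPEPO.traceNorm
              (GibbsPEPO.gibbs β h - GibbsPEPO.truncatedTrotter ord h β M L) ≤
            ε * GibbsPEPO.traceNorm (GibbsPEPO.gibbs β h) ∧
          (∀ i, GibbsPEPO.SchmidtRankLE (ord (GibbsPEPO.column K i) : Sym2 V) (d ^ 2)
            (GibbsPEPO.trotterTerm ord h β M i)) ∧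
          ∀ s : ℕ, 1 ≤ s → s ≤ d ^ 2 →
            (∀ i, GibbsPEPO.SchmidtRankLE (ord (GibbsPEPO.column K i) : Sym2 V) s
              (GibbsPEPO.trotterTerm ord h β M i)) →
            ∃ D : ℕ, GibbsPEPO.IsPEPO G D (GibbsPEPO.truncatedTrotter ord h β M L) ∧
              D ≤ L ^ 2 * (s * M) ^ (2 * L) ∧
              (D : ℝ) ≤ Real.exp (C' * Real.log (Fintype.card V / ε) ^ 2)) ∧
    (∀ (d : ℕ) (Δ κ : ℝ), 1 ≤ d → 0 < Δ → 0 ≤ κ → ∃ C : ℝ, 0 < C ∧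
      ∀ (V : Type u) [Fintype V] [DecidableEq V] (G : SimpleGraph V) [DecidableRel G.Adj]
        (z : ℕ) (γ : ℝ) (h : G.edgeSet → GibbsPEPO.Op V d)
        (hh : GibbsPEPO.IsInteraction G h) (Ψ : (V → Fin d) → ℂ) (E₀ ε : ℝ),
        G.Connected → (∀ v, G.degree v < z) → GibbsPEPO.LatticeGrowthLE G γ →
        2 ≤ G.edgeFinset.card →
        GibbsPEPO.IsGappedGroundState (GibbsPEPO.hamiltonian h) Ψ E₀ Δ →
        (∀ E : ℝ, 0 ≤ E →
          (GibbsPEPO.levelCount (GibbsPEPO.isHermitian_hamiltonian hh) (E₀ + E) : ℝ) ≤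
            (Fintype.card V : ℝ) ^ (κ * (1 + E))) →
        0 < ε → ε ≤ 1 →
        ∃ D : ℕ, (D : ℝ) ≤ Real.exp (C * Real.log (Fintype.card V / ε) ^ 2) ∧
          (∃ σ : GibbsPEPO.Op V d, GibbsPEPO.IsPEPO G D σ ∧
            GibbsPEPO.traceNorm (Matrix.vecMulVec Ψ (star Ψ) - σ) ≤ ε) ∧
          ∃ Φ : (V → Fin d) → ℂ, GibbsPEPO.IsPEPS G D Φ ∧
            ‖WithLp.toLp 2 (Ψ - Φ)‖ ≤ ε) := by
  constructor
  · intro b hb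
    obtain ⟨C, p, hC, hmain⟩ := GibbsPEPO.exists_truncatedTrotter_approx.{u} b hb
    refine ⟨C, p, hC, fun d hd => ?_⟩
    obtain ⟨C', hC', hmain⟩ := hmain d hd
    refine ⟨C', hC', ?_⟩
    intro V _ _ G _ _ _ K ord h β ε hG _ _ hK hh hβ hβb hε hε1
    -- Since `ε ≤ 1`, the range `β ≤ b log N` lies inside `β ≤ b log (N/ε)`.
    refine hmain V G K ord h β ε hG hK hh hβ (hβb.trans ?_) hε hε1
    have : Nonempty V := hG.nonempty
    have hN : (0 : ℝ) < Fintype.card V := by exact_mod_cast Fintype.card_pos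
    refine mul_le_mul_of_nonneg_left (Real.log_le_log hN ?_) hb
    exact le_div_self hN.le hε hε1
  · intro d Δ κ hd hΔ hκ
    obtain ⟨C, hC, hmain⟩ := GibbsPEPO.exists_groundState_approx.{u} d Δ κ hd hΔ hκ
    refine ⟨C, hC, ?_⟩
    intro V _ _ G _ _ _ h hh Ψ E₀ ε hG _ _ hK hΨ hcount hε hε1
    exact hmain V G h hh Ψ E₀ ε hG hK hΨ hcount hε hε1
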